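/- Let $k\in\{1,2,3\}$ and let $d\ge 1$ be an integer. If $k=1$ let $D=(0,b)$ with $b>0$; if $k=2,3$ let $D=B_1(0)\subset\mathbb R^k$ be the open unit ball. Let $G_D^k$ be the Green function of the Laplace equation on $D$ with Dirichlet boundary condition, that is, $G^1_D(x,y)=x\wedge y-\frac{xy}{b}$, and for $k=2,3$ $$G_D^k(x,y)=\Gamma^k(|x-y|)-\Gamma^k\Big(|y|\,\Big|x-\frac{y}{|y|^2}\Big|\Big)\ (y\ne0),\qquad G_D^k(x,0)=\Gamma^k(|x|)-\Gamma^k(1),$$ with $\Gamma^2(r)=\frac1{2\pi}\log r$ and $\Gamma^3(r)=\frac1{4\pi r}$ (for $k=2$ this is the Green function of $-\Delta$ up to sign, which does not affect the law of the process $v$ below). Let $W=(W^1,\dots,W^d)$ be a $d$-dimensional Gaussian white noise on $D$, that is, the variables $W^i(h)=\int_D h(y)\,W^i(dy)$, $1\le i\le d$, $h\in L^2(D)$, are jointly Gaussian and centred with $\mathbb E[W^i(g)W^j(h)]=\delta_{ij}\langle g,h\rangle_{L^2(D)}$. Let $v=\{v(x),\,x\in D\}$ be the $\mathbb R^d$-valued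 Gaussian process $$v^i(x)=\int_D G_D^k(x,y)\,W^i(dy),\qquad x\in D,\ i=1,\dots,d,$$ in a version with almost surely continuous sample paths. Let $\xi=1$ if $k=1$, $\xi=1-\gamma$ with an arbitrary $\gamma\in(0,1)$ if $k=2$, and $\xi=\frac12$ if $k=3$. Then for every $d_0>0$ there exists a constant $C>0$, depending only on $D,k,d,d_0$ (and on $\gamma$ if $k=2$), such that for every compact set $I\subset D$ all of whose points have distance at least $d_0$ from $\partial D$, and every Borel set $A\subset\mathbb R^d$, $$P\{v(I)\cap A\neq\emptyset\}\le C\,\mathcal H_{d-\frac k\xi}(A).$$ Here $\mathcal H_s$ is the $s$-dimensional Hausdorff measure on $\mathbb R^d$; for $s<0$, $\mathcal H_s(A)=\infty$ if $A\ne\emptyset$ and $\mathcal H_s(\emptyset)=0$. -/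

import Mathlib

open MeasureTheory ProbabilityTheory

namespace PoissonHitting

/-- `ℝ^n` with its Euclidean norm. -/
abbrev Euc (n : ℕ) : Type := EuclideanSpace ℝ (Fin n)

/-- The domain `D ⊂ ℝ^k`: the interval `(0, b)` if `k = 1`, and the open unit ball (which does
not involve `b`) otherwise. -/
def domain (k : ℕ) (b : ℝ) : Set (Euc k) :=
  if k = 1 then {x | ∀ i, x i ∈ Set.Ioo 0 b} else Metric.ball 0 1

/-- The radial function `Γ^k`: `(2π)⁻¹ log r` if `k = 2`, and `(4π)⁻¹ r⁻¹` if `k = 3`.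
Only `k = 2, 3` are used. -/
noncomputable def fundSol (k : ℕ) (r : ℝ) : ℝ :=
  if k = 2 then 1 / (2 * Real.pi) * Real.log r else 1 / (4 * Real.pi) * r⁻¹

/-- The Green function of the Laplace equation on `domain k b` with Dirichlet boundary condition,
for `k = 1, 2, 3`. For `k = 2` the sign is that of `Γ^2 = (2π)⁻¹ log`; as white noise is symmetric,
the sign is irrelevant for the law of the process below. The value at `x = y` (`k = 2, 3`) is
immaterial, since only the class of `y ↦ green k b x y` in `L²(D)` is used. -/
noncomputable def green : (k : ℕ) → ℝ → Euc k → Euc k → ℝ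
  | 1, b, x, y => min (x 0) (y 0) - x 0 * y 0 / b
  | k, _, x, y =>
    if y = 0 then fundSol k ‖x‖ - fundSol k 1
    else fundSol k ‖x - y‖ - fundSol k (‖y‖ * ‖x - (‖y‖ ^ 2)⁻¹ • y‖)

/-- The exponent `ξ`: `1`, `1 - γ`, `1/2` for `k = 1, 2, 3`. -/
noncomputable def xi (k : ℕ) (γ : ℝ) : ℝ :=
  if k = 1 then 1 else if k = 2 then 1 - γ else 1 / 2

/-- `W = (W^1, …, W^d)` is a `d`-dimensional Gaussian white noise with control measure `μ`: the
`W^i(h)`, `h ∈ L²(μ)`, are jointly Gaussian and centred, and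
`E[W^i(g) W^j(h)] = δ_{ij} ⟨g, h⟩_{L²(μ)}`. -/
structure IsWhiteNoise {S Ω : Type*} [MeasurableSpace S] [MeasurableSpace Ω] {d : ℕ}
    (μ : Measure S) (W : Fin d → Lp ℝ 2 μ → Ω → ℝ) (P : Measure Ω) : Prop where
  isGaussianProcess : IsGaussianProcess (fun p : Fin d × Lp ℝ 2 μ => W p.1 p.2) P
  mean_zero : ∀ (i : Fin d) (h : Lp ℝ 2 μ), ∫ ω, W i h ω ∂P = 0
  covariance : ∀ (i j : Fin d) (g h : Lp ℝ 2 μ),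
    ∫ ω, W i g ω * W j h ω ∂P = if i = j then inner ℝ g h else 0

open Classical in
/-- The Wiener integral `∫ h dW` of a (deterministic) square integrable function `h` with respect
to one component of a white noise; it is set to `0` if `h ∉ L²(μ)`. -/
noncomputable def wienerIntegral {S Ω : Type*} [MeasurableSpace S] {μ : Measure S}
    (W : Lp ℝ 2 μ → Ω → ℝ) (h : S → ℝ) : Ω → ℝ :=
  if hh : MemLp h 2 μ then W (hh.toLp h) else 0

/-- `v` is the Gaussian process `v^i(x) = ∫_D G_D^k(x, y) W^i(dy)`, `x ∈ D`, `i = 1, …, d`, in a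
version with almost surely continuous sample paths on `D`. -/
structure IsGaussianSolution {Ω : Type*} [MeasurableSpace Ω] {k d : ℕ} (b : ℝ)
    (W : Fin d → Lp ℝ 2 ((volume : Measure (Euc k)).restrict (domain k b)) → Ω → ℝ)
    (v : Euc k → Ω → Euc d) (P : Measure Ω) : Prop where
  ae_eq : ∀ x ∈ domain k b, ∀ i : Fin d,
    (fun ω => v x ω i) =ᵐ[P] wienerIntegral (W i) (green k b x)
  ae_continuousOn : ∀ᵐ ω ∂P, ContinuousOn (fun x => v x ω) (domain k b)

end PoissonHitting

open PoissonHitting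

open PoissonHitting

namespace PoissonHitting

open scoped ENNReal NNReal
open Set

-- The probability that `v` hits a ball of radius `ε` is shown to be `O(ε ^ (d - k / ξ))`; covering
-- `A` by small sets and summing then gives the Hausdorff bound.
--
-- For the ball estimate, the map `x ↦ G(x, ·)` into `L²(D)` is `ξ`-Hölder on compact subsets of
-- `D`. It never vanishes, so its norm is bounded below on such sets. Points at distance at least
-- `d₀` from the boundary are covered by `O(ε ^ (-k / ξ))` cubes of side `ε ^ (1 / ξ)`, on each of
-- which the kernels vary by `O(ε)` in norm. The components of `v` are independent, so it suffices
-- that one component comes within `O(ε)` of a given value on a cube with probability `O(ε)`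
-- (`exists_component_hitting_const`).
--
-- That bound (`exists_hitting_const`) comes from regression on the value at the corner of the cube.
-- With `g₀` the corner kernel and `g` another one, `X g = c * X g₀ + X r`, where `r ⊥ g₀` and `c -
-- 1 = O(ε)`. A near hit forces `|X g₀ - z| ≤ U * (1 + |X g₀|)`, where `U` is `O(ε)` plus the
-- supremum of the residuals and is independent of `X g₀`. Given `U`, the Gaussian density bounds
-- the probability by a constant times `U`. Hence only `E U = O(ε)` is needed, and this follows by
-- chaining over dyadic points (`exists_chaining_const`).

universe u

/-! ### From small sets to Hausdorff measure. -/

section Hausdorff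

variable {Ω X : Type*} [MeasurableSpace Ω] {P : Measure Ω}
  [EMetricSpace X] [MeasurableSpace X] [BorelSpace X]

/-- If the probability that a random set hits a small set `E` is at most `C (diam E) ^ s`, then
the probability that it hits `A` is at most `C` times the `s`-dimensional Hausdorff measure. -/
theorem measure_hitting_le_hausdorffMeasure (Z : Ω → Set X) {C r₀ : ℝ≥0∞} {s : ℝ}
    (hC : C ≠ 0) (hC' : C ≠ ∞) (hr₀ : 0 < r₀)
    (h : ∀ E : Set X, E.Nonempty → Metric.ediam E ≤ r₀ →
      P {ω | (Z ω ∩ E).Nonempty} ≤ C * Metric.ediam E ^ s) (A : Set X) :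
    P {ω | (Z ω ∩ A).Nonempty} ≤ C * μH[s] A := by
  rw [mul_comm, ← ENNReal.div_le_iff_le_mul (Or.inl hC) (Or.inl hC'),
    Measure.hausdorffMeasure_apply]
  -- The Hausdorff measure is a supremum over mesh sizes, so covers of mesh `r₀` alone suffice.
  refine le_iSup₂_of_le r₀ hr₀ (le_iInf fun t => le_iInf fun hA => le_iInf fun ht => ?_)
  rw [ENNReal.div_le_iff_le_mul (Or.inl hC) (Or.inl hC'), mul_comm,
    ← ENNReal.tsum_mul_left]
  have hsub : {ω | (Z ω ∩ A).Nonempty} ⊆ ⋃ n, {ω | (Z ω ∩ t n).Nonempty} := by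
    rintro ω ⟨x, hxZ, hxA⟩
    obtain ⟨n, hn⟩ := mem_iUnion.1 (hA hxA)
    exact mem_iUnion.2 ⟨n, x, hxZ, hn⟩
  refine (measure_mono hsub).trans ((measure_iUnion_le _).trans (ENNReal.tsum_le_tsum fun n => ?_))
  -- Empty pieces contribute nothing to the Hausdorff sum; this matters for `s ≤ 0`, where `0 ^ s`
  -- is not `0`.
  rcases (t n).eq_empty_or_nonempty with hn | hn
  · simp [hn]
  · simpa [hn] using h _ hn (ht n)

end Hausdorff

/-! ### Isonormal Gaussian processes. -/

section Gaussian

variable {Ω H : Type*} [MeasurableSpace Ω] {P : Measure Ω}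
  [NormedAddCommGroup H] [InnerProductSpace ℝ H]

/-- An isonormal Gaussian process indexed by an inner product space. -/
structure IsIsonormal (X : H → Ω → ℝ) (P : Measure Ω) : Prop where
  isGaussianProcess : IsGaussianProcess X P
  mean_zero : ∀ h, ∫ ω, X h ω ∂P = 0
  covariance : ∀ g h, ∫ ω, X g ω * X h ω ∂P = inner ℝ g h

namespace IsIsonormal

variable {X : H → Ω → ℝ}

theorem memLp_two (hX : IsIsonormal X P) (h : H) : MemLp (X h) 2 P :=
  (hX.isGaussianProcess.hasGaussianLaw_eval h).memLp_two

theorem aemeasurable (hX : IsIsonormal X P) (h : H) : AEMeasurable (X h) P :=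
  hX.isGaussianProcess.aemeasurable h

theorem map_eq (hX : IsIsonormal X P) (h : H) :
    P.map (X h) = gaussianReal 0 (‖h‖₊ ^ 2) := by
  rw [(hX.isGaussianProcess.hasGaussianLaw_eval h).map_eq_gaussianReal, hX.mean_zero,
    variance_of_integral_eq_zero (hX.aemeasurable h) (hX.mean_zero h)]
  congr 1
  have := hX.covariance h h
  rw [real_inner_self_eq_norm_sq] at this
  simp only [sq] at this ⊢
  rw [this]
  ext
  simp [mul_self_nonneg]

theorem cov_eq (hX : IsIsonormal X P) (g h : H) : cov[X g, X h; P] = inner ℝ g h := by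
  have := hX.isGaussianProcess.isProbabilityMeasure
  rw [covariance_eq_sub (hX.memLp_two g) (hX.memLp_two h), hX.mean_zero, hX.mean_zero]
  simpa using hX.covariance g h

/-- Linearity is not part of the definition: expanding by the covariances, the second moment of the
difference of the two sides vanishes. -/
theorem map_add_smul_ae (hX : IsIsonormal X P) (g h : H) (c : ℝ) :
    X (g + c • h) =ᵐ[P] fun ω => X g ω + c * X h ω := by
  have hi : ∀ a b : H, Integrable (fun ω => X a ω * X b ω) P := fun a b =>
    (hX.memLp_two a).integrable_mul (hX.memLp_two b)
  have hm : MemLp (fun ω => X (g + c • h) ω - X g ω - c * X h ω) 2 P :=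
    ((hX.memLp_two _).sub (hX.memLp_two _)).sub ((hX.memLp_two h).const_mul c)
  have hz : ∫ ω, (X (g + c • h) ω - X g ω - c * X h ω) ^ 2 ∂P = 0 := by
    have : ∀ ω, (X (g + c • h) ω - X g ω - c * X h ω) ^ 2 =
        X (g + c • h) ω * X (g + c • h) ω + X g ω * X g ω + c ^ 2 * (X h ω * X h ω)
        - 2 * (X (g + c • h) ω * X g ω) - 2 * c * (X (g + c • h) ω * X h ω)
        + 2 * c * (X g ω * X h ω) := fun ω => by ring
    simp_rw [this]
    rw [integral_add, integral_sub, integral_sub, integral_add, integral_add]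
    · simp only [integral_const_mul, hX.covariance, inner_add_left, inner_add_right,
        inner_smul_left, inner_smul_right, real_inner_comm g h]
      simp
      ring
    all_goals fun_prop (disch := exact hi _ _)
  have := (integral_eq_zero_iff_of_nonneg (fun ω => sq_nonneg _) hm.integrable_sq).1 hz
  filter_upwards [this] with ω hω
  have := pow_eq_zero_iff (two_ne_zero) |>.1 hω
  linarith

theorem map_sub_ae (hX : IsIsonormal X P) (g h : H) :
    X (g - h) =ᵐ[P] fun ω => X g ω - X h ω := by
  filter_upwards [hX.map_add_smul_ae g h (-1)] with ω hω
  rw [sub_eq_add_neg, ← neg_one_smul ℝ h, hω]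
  ring

theorem map_zero_ae (hX : IsIsonormal X P) : X 0 =ᵐ[P] 0 := by
  filter_upwards [hX.map_sub_ae 0 0] with ω hω
  simpa using hω

/-- Absolute moments of an isonormal process. -/
theorem lintegral_enorm_pow (hX : IsIsonormal X P) (h : H) (q : ℕ) :
    ∫⁻ ω, ‖X h ω‖ₑ ^ q ∂P = ‖h‖ₑ ^ q * ∫⁻ x, ‖x‖ₑ ^ q ∂gaussianReal 0 1 := by
  have h1 : ∫⁻ ω, ‖X h ω‖ₑ ^ q ∂P = ∫⁻ x, ‖x‖ₑ ^ q ∂(P.map (X h)) := by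
    rw [lintegral_map' (by fun_prop) (hX.aemeasurable h)]
  have h2 : gaussianReal 0 (‖h‖₊ ^ 2) = (gaussianReal 0 1).map (‖h‖ * ·) := by
    rw [gaussianReal_map_const_mul]
    congr 1
    · simp
    · ext; simp
  rw [h1, hX.map_eq, h2, lintegral_map (by fun_prop) (by fun_prop)]
  simp_rw [enorm_mul, mul_pow]
  rw [lintegral_const_mul _ (by fun_prop)]
  simp

end IsIsonormal

theorem lintegral_enorm_pow_gaussianReal_lt_top (q : ℕ) :
    ∫⁻ x, ‖x‖ₑ ^ q ∂gaussianReal 0 1 < ∞ := by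
  have h := memLp_id_gaussianReal (μ := 0) (v := 1) (q : ℝ≥0)
  rcases Nat.eq_zero_or_pos q with rfl | hq
  · simp
  · have := lintegral_rpow_enorm_lt_top_of_eLpNorm_lt_top (p := (q : ℝ≥0)) (f := (id : ℝ → ℝ))
      (μ := gaussianReal 0 1) (by simpa using hq.ne') (by simp) h.2
    simpa using this

end Gaussian

/-! ### Near hits of one Gaussian variable, and regression on it. -/

/-- Decay of order `1 / (1 + |x|)` offsets windows whose width grows like `1 + |x|`, which makes the
next estimate uniform in the target. It follows from `exp (-y) ≤ 1 / (1 + y)` and the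
arithmetic-geometric mean inequality. -/
theorem gaussianPDFReal_le_div {v₁ v₂ : ℝ} (hv₁ : 0 < v₁) {v : ℝ≥0} (h₁ : v₁ ≤ v) (h₂ : v ≤ v₂)
    (x : ℝ) :
    gaussianPDFReal 0 v x ≤ (√(2 * Real.pi * v₁))⁻¹ * (1 + 2 * v₂) / (1 + |x|) := by
  have hv : (0 : ℝ) < v := hv₁.trans_le h₁
  have hv₂ : 0 < v₂ := hv.trans_le h₂
  have hpi := Real.pi_pos
  have hx : 0 < 1 + |x| := by positivity
  have ha : 0 < 1 + x ^ 2 / (2 * v₂) := by positivity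
  have hexp : Real.exp (-(x - 0) ^ 2 / (2 * v)) ≤ (1 + 2 * v₂) / (1 + |x|) := by
    calc Real.exp (-(x - 0) ^ 2 / (2 * v))
        ≤ Real.exp (-(x ^ 2 / (2 * v₂))) := by
          rw [Real.exp_le_exp, sub_zero, neg_div, neg_le_neg_iff]
          gcongr
      _ ≤ (1 + x ^ 2 / (2 * v₂))⁻¹ := by
          rw [Real.exp_neg]
          gcongr
          rw [add_comm]
          exact Real.add_one_le_exp _
      _ ≤ (1 + 2 * v₂) / (1 + |x|) := by
          rw [inv_eq_one_div, div_le_div_iff₀ ha hx]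
          have h3 : 2 * |x| ≤ 2 * v₂ + x ^ 2 / (2 * v₂) := by
            have : 2 * v₂ + x ^ 2 / (2 * v₂) - 2 * |x| = (2 * v₂ - |x|) ^ 2 / (2 * v₂) := by
              field_simp
              rw [← sq_abs x]
              ring
            have h4 : 0 ≤ (2 * v₂ - |x|) ^ 2 / (2 * v₂) := by positivity
            linarith
          have h5 : 0 ≤ 2 * v₂ * (x ^ 2 / (2 * v₂)) := by positivity
          nlinarith [abs_nonneg x]
  rw [gaussianPDFReal, mul_div_assoc]
  gcongr

/-- A centred Gaussian variable with variance bounded away from `0` and `∞` is within relative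
distance `u` of a given point with probability `O(u)`. -/
theorem exists_gaussianReal_near_le {v₁ v₂ : ℝ} (hv₁ : 0 < v₁) :
    ∃ C : ℝ, 0 < C ∧ ∀ v : ℝ≥0, v₁ ≤ v → v ≤ v₂ → ∀ (z : ℝ) (u : ℝ≥0∞),
      gaussianReal 0 v {x | ‖x - z‖ₑ ≤ u * ENNReal.ofReal (1 + |x|)} ≤ ENNReal.ofReal C * u := by
  set B := (√(2 * Real.pi * v₁))⁻¹ * (1 + 2 * v₂) with hB
  -- The `2` makes the bound trivial for `u ≥ 1/2`. For `u < 1/2`, `1 + |x|` and `1 + |z|` agree up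
  -- to a factor `2` on the event; density `2|B| / (1 + |z|)` times length `4u(1 + |z|)` gives
  -- `8|B|u`.
  refine ⟨8 * |B| + 2, by positivity, fun v h₁ h₂ z u => ?_⟩
  have hv0 : v ≠ 0 := by
    rintro rfl
    exact absurd (hv₁.trans_le h₁) (by simp)
  rcases le_or_gt (1 / 2) u with hu | hu
  · refine prob_le_one.trans ?_
    calc (1 : ℝ≥0∞) = 2 * (1 / 2) := by
          rw [ENNReal.mul_div_cancel (by simp) (by simp)]
      _ ≤ ENNReal.ofReal (8 * |B| + 2) * u := by
          gcongr
          rw [← ENNReal.ofReal_ofNat]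
          exact ENNReal.ofReal_le_ofReal (by linarith [abs_nonneg B])
  · lift u to ℝ≥0 using (hu.trans_le (by simp)).ne
    obtain ⟨t, ht⟩ : ∃ t : ℝ, t = u := ⟨_, rfl⟩
    have ht0 : 0 ≤ t := ht ▸ u.2
    have ht1 : t < 1 / 2 := by
      rw [ht]
      have : u < 1 / 2 := by
        rw [← ENNReal.coe_lt_coe]; simpa using hu
      exact_mod_cast this
    have hu' : (u : ℝ≥0∞) = ENNReal.ofReal t := by rw [ht]; simp
    have hset : ∀ x, x ∈ {x : ℝ | ‖x - z‖ₑ ≤ (u : ℝ≥0∞) * ENNReal.ofReal (1 + |x|)} →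
        |x - z| ≤ t * (1 + |x|) := by
      intro x hx
      rw [mem_ofPred_eq, hu', ← ENNReal.ofReal_mul ht0, Real.enorm_eq_ofReal_abs,
        ENNReal.ofReal_le_ofReal_iff (by positivity)] at hx
      exact hx
    have hz : 0 < 1 + |z| := by positivity
    have hbd : ∀ x, x ∈ {x : ℝ | ‖x - z‖ₑ ≤ (u : ℝ≥0∞) * ENNReal.ofReal (1 + |x|)} →
        1 + |x| ≤ 2 * (1 + |z|) ∧ 1 + |z| ≤ 2 * (1 + |x|) := by
      intro x hx
      have h3 := hset x hx
      have h4 := abs_sub_abs_le_abs_sub x z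
      have h5 := abs_sub_abs_le_abs_sub z x
      rw [abs_sub_comm] at h5
      constructor <;> nlinarith [abs_nonneg x, abs_nonneg z]
    rw [gaussianReal_apply _ hv0]
    have hmeas : MeasurableSet {x : ℝ | ‖x - z‖ₑ ≤ (u : ℝ≥0∞) * ENNReal.ofReal (1 + |x|)} :=
      measurableSet_le (by fun_prop) (by fun_prop)
    calc ∫⁻ x in {x | ‖x - z‖ₑ ≤ (u : ℝ≥0∞) * ENNReal.ofReal (1 + |x|)}, gaussianPDF 0 v x
        ≤ ∫⁻ x in {x | ‖x - z‖ₑ ≤ (u : ℝ≥0∞) * ENNReal.ofReal (1 + |x|)},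
            ENNReal.ofReal (2 * |B| / (1 + |z|)) := by
          refine setLIntegral_mono' hmeas fun x hx => ENNReal.ofReal_le_ofReal ?_
          refine (gaussianPDFReal_le_div hv₁ h₁ h₂ x).trans ?_
          rw [← hB, div_le_div_iff₀ (by positivity) hz]
          have := (hbd x hx).2
          nlinarith [abs_nonneg B, le_abs_self B]
      _ = ENNReal.ofReal (2 * |B| / (1 + |z|)) *
            volume {x : ℝ | ‖x - z‖ₑ ≤ (u : ℝ≥0∞) * ENNReal.ofReal (1 + |x|)} := by
          rw [setLIntegral_const]
      _ ≤ ENNReal.ofReal (2 * |B| / (1 + |z|)) *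
            volume (Icc (z - 2 * t * (1 + |z|)) (z + 2 * t * (1 + |z|))) := by
          gcongr
          intro x hx
          have h3 := abs_le.1 (hset x hx)
          have h4 := (hbd x hx).1
          constructor <;> nlinarith
      _ = ENNReal.ofReal (8 * |B|) * u := by
          rw [Real.volume_Icc, hu', ← ENNReal.ofReal_mul (by positivity),
            ← ENNReal.ofReal_mul (by positivity)]
          congr 1
          field_simp
          ring
      _ ≤ ENNReal.ofReal (8 * |B| + 2) * u := by
          gcongr
          linarith

section Residual

variable {H : Type*} [NormedAddCommGroup H] [InnerProductSpace ℝ H]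

/-- The component of `h` orthogonal to `g`. -/
noncomputable def residual (g h : H) : H := h - (inner ℝ g h / ‖g‖ ^ 2) • g

theorem inner_residual {g : H} (hg : g ≠ 0) (h : H) : inner ℝ g (residual g h) = 0 := by
  have : ‖g‖ ^ 2 ≠ 0 := by simpa using hg
  rw [residual, inner_sub_right, inner_smul_right, real_inner_self_eq_norm_sq,
    div_mul_cancel₀ _ this, sub_self]

theorem residual_self {g : H} (hg : g ≠ 0) : residual g g = 0 := by
  have : ‖g‖ ^ 2 ≠ 0 := by simpa using hg
  rw [residual, real_inner_self_eq_norm_sq, div_self this, one_smul, sub_self]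

theorem residual_sub (g h h' : H) : residual g h - residual g h' = residual g (h - h') := by
  simp only [residual, inner_sub_right, sub_div, sub_smul]
  abel

theorem norm_residual_le {g : H} (hg : g ≠ 0) (h : H) : ‖residual g h‖ ≤ ‖h‖ := by
  have h1 : inner ℝ (residual g h) ((inner ℝ g h / ‖g‖ ^ 2) • g) = 0 := by
    rw [inner_smul_right, real_inner_comm g (residual g h), inner_residual hg, mul_zero]
  have h2 : ‖h‖ ^ 2 = ‖residual g h‖ ^ 2 + ‖(inner ℝ g h / ‖g‖ ^ 2) • g‖ ^ 2 := by
    have := norm_add_sq_eq_norm_sq_add_norm_sq_of_inner_eq_zero _ _ h1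
    rw [show residual g h + (inner ℝ g h / ‖g‖ ^ 2) • g = h by simp [residual]] at this
    simpa [sq] using this
  exact abs_le_of_sq_le_sq' (by nlinarith [sq_nonneg ‖(inner ℝ g h / ‖g‖ ^ 2) • g‖])
    (norm_nonneg _) |>.2

/-- By Cauchy-Schwarz, the regression coefficient of a vector near `g` on `g` is close to `1`. -/
theorem abs_inner_div_sub_one_le {g : H} (hg : g ≠ 0) (h : H) :
    |inner ℝ g h / ‖g‖ ^ 2 - 1| ≤ ‖h - g‖ / ‖g‖ := by
  have hg' : 0 < ‖g‖ := norm_pos_iff.2 hg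
  have : inner ℝ g h / ‖g‖ ^ 2 - 1 = inner ℝ g (h - g) / ‖g‖ ^ 2 := by
    rw [inner_sub_right, real_inner_self_eq_norm_sq]
    field_simp
  rw [this, abs_div, abs_of_pos (pow_pos hg' 2), div_le_div_iff₀ (pow_pos hg' 2) hg']
  nlinarith [abs_real_inner_le_norm g (h - g)]

end Residual

namespace IsIsonormal

variable {Ω H : Type*} [MeasurableSpace Ω] {P : Measure Ω}
  [NormedAddCommGroup H] [InnerProductSpace ℝ H] {X : H → Ω → ℝ}

/-- Orthogonality means zero covariance, hence independence for jointly Gaussian families;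
countability keeps the supremum measurable. -/
theorem indepFun_iSup_residual (hX : IsIsonormal X P) {ι : Type*} [Countable ι] {g₀ : H}
    (hg₀ : g₀ ≠ 0) (g : ι → H) :
    IndepFun (X g₀) (fun ω => ⨆ t, ‖X (residual g₀ (g t)) ω‖ₑ) P := by
  have h := IsGaussianProcess.indepFun_of_covariance_eq_zero (P := P)
    (X := fun _ : Unit => X g₀) (Y := fun t => X (residual g₀ (g t))) ?_
    (fun _ => hX.aemeasurable _) (fun _ => hX.aemeasurable _) ?_
  · exact h.comp (φ := fun y : Unit → ℝ => y ()) (ψ := fun y : ι → ℝ => ⨆ t, ‖y t‖ₑ)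
      (by fun_prop) (by fun_prop)
  · have := hX.isGaussianProcess.comp_right
      (Sum.elim (fun _ : Unit => g₀) (fun t => residual g₀ (g t)))
    convert! this using 1
    ext (_ | _) <;> rfl
  · intro _ t
    rw [hX.cov_eq, inner_residual hg₀]

end IsIsonormal

/-- A Gaussian family whose members are within `s` of a fixed nondegenerate variable and whose
residual supremum has expectation `O(s)` approaches a given point within `s` with
probability `O(s)`. -/
theorem exists_hitting_const {H : Type*} [NormedAddCommGroup H] [InnerProductSpace ℝ H]
    {σ₁ : ℝ} (hσ : 0 < σ₁) (σ₂ : ℝ) (C₀ : ℝ) :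
    ∃ C : ℝ, 0 < C ∧ ∀ (Ω : Type u) [MeasurableSpace Ω] (P : Measure Ω) (X : H → Ω → ℝ),
      IsIsonormal X P → ∀ (ι : Type) [Countable ι] (g : ι → H) (g₀ : H) (s : ℝ), 0 < s →
      σ₁ ≤ ‖g₀‖ → ‖g₀‖ ≤ σ₂ → (∀ t, ‖g t - g₀‖ ≤ s) →
      ∫⁻ ω, ⨆ t, ‖X (residual g₀ (g t)) ω‖ₑ ∂P ≤ ENNReal.ofReal (C₀ * s) →
      ∀ z : ℝ, P {ω | ∃ t, |X (g t) ω - z| < s} ≤ ENNReal.ofReal (C * s) := by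
  obtain ⟨C₁, hC₁, hC₁'⟩ := exists_gaussianReal_near_le (v₁ := σ₁ ^ 2) (v₂ := σ₂ ^ 2) (by positivity)
  refine ⟨C₁ * (1 + 1 / σ₁ + |C₀|), by positivity, ?_⟩
  intro Ω _ P X hX ι _ g g₀ s hs h₁ h₂ hgs hSint z
  have := hX.isGaussianProcess.isProbabilityMeasure
  have hg0 : g₀ ≠ 0 := norm_pos_iff.1 (hσ.trans_le h₁)
  -- `s` accounts for the distance of `X (g t)` to `z`, and `s / σ₁` for the error in the regression
  -- coefficient.
  set a := s * (1 + 1 / σ₁) with ha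
  have ha0 : 0 ≤ a := by positivity
  set U : Ω → ℝ≥0∞ := fun ω => ENNReal.ofReal a + ⨆ t, ‖X (residual g₀ (g t)) ω‖ₑ with hU
  have hSm : AEMeasurable (fun ω => ⨆ t, ‖X (residual g₀ (g t)) ω‖ₑ) P :=
    AEMeasurable.iSup fun t => (hX.aemeasurable _).enorm
  have hUm : AEMeasurable U P := hSm.const_add _
  have hind : IndepFun (X g₀) U P :=
    (hX.indepFun_iSup_residual hg0 g).comp (φ := id) (ψ := fun y => ENNReal.ofReal a + y)
      measurable_id (by fun_prop)
  set T : Set (ℝ × ℝ≥0∞) := {p | ‖p.1 - z‖ₑ ≤ p.2 * ENNReal.ofReal (1 + |p.1|)} with hT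
  have hTm : MeasurableSet T := measurableSet_le (by fun_prop) (by fun_prop)
  have hlin : ∀ᵐ ω ∂P, ∀ t, X (residual g₀ (g t)) ω =
      X (g t) ω - inner ℝ g₀ (g t) / ‖g₀‖ ^ 2 * X g₀ ω := by
    rw [ae_all_iff]
    intro t
    filter_upwards [hX.map_add_smul_ae (g t) g₀ (-(inner ℝ g₀ (g t) / ‖g₀‖ ^ 2))] with ω hω
    rw [residual, sub_eq_add_neg, ← neg_smul, hω]
    ring
  have hsub : P {ω | ∃ t, |X (g t) ω - z| < s} ≤ P ((fun ω => (X g₀ ω, U ω)) ⁻¹' T) := by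
    refine measure_mono_ae ?_
    filter_upwards [hlin] with ω hω
    rintro ⟨t, ht⟩
    change ‖X g₀ ω - z‖ₑ ≤ (ENNReal.ofReal a + _) * ENNReal.ofReal (1 + |X g₀ ω|)
    have hc := abs_inner_div_sub_one_le hg0 (g t)
    set c := inner ℝ g₀ (g t) / ‖g₀‖ ^ 2 with hcdef
    have hc' : |c - 1| ≤ s / σ₁ :=
      hc.trans (div_le_div₀ hs.le (hgs t) hσ h₁)
    have hkey : |X g₀ ω - z| ≤ (a + |X (residual g₀ (g t)) ω|) * (1 + |X g₀ ω|) := by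
      have e : X g₀ ω - z = (X (g t) ω - z) - (c - 1) * X g₀ ω - X (residual g₀ (g t)) ω := by
        rw [hω t]; ring
      have h3 : |X g₀ ω - z| ≤ |X (g t) ω - z| + |c - 1| * |X g₀ ω|
          + |X (residual g₀ (g t)) ω| := by
        rw [e, ← abs_mul]
        exact (abs_sub _ _).trans (by gcongr; exact abs_sub _ _)
      have h4 : |c - 1| * |X g₀ ω| ≤ s / σ₁ * |X g₀ ω| := by gcongr
      have h5 : a = s + s / σ₁ := by rw [ha]; ring
      have h6 : 0 ≤ s / σ₁ := by positivity
      rw [h5]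
      nlinarith [abs_nonneg (X g₀ ω), abs_nonneg (X (residual g₀ (g t)) ω),
        mul_nonneg hs.le (abs_nonneg (X g₀ ω)),
        mul_nonneg (abs_nonneg (X (residual g₀ (g t)) ω)) (abs_nonneg (X g₀ ω))]
    rw [Real.enorm_eq_ofReal_abs]
    refine (ENNReal.ofReal_le_ofReal hkey).trans ?_
    rw [ENNReal.ofReal_mul (by positivity), ENNReal.ofReal_add ha0 (abs_nonneg _)]
    gcongr
    rw [← Real.enorm_eq_ofReal_abs]
    exact le_iSup (fun t => ‖X (residual g₀ (g t)) ω‖ₑ) t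
  refine hsub.trans ?_
  -- By independence the joint law is a product; at a fixed value `u` of `U` the slice has
  -- probability at most `C₁ * u`, so integration leaves `C₁ * E U`.
  rw [← Measure.map_apply_of_aemeasurable ((hX.aemeasurable g₀).prodMk hUm) hTm,
    (indepFun_iff_map_prod_eq_prod_map_map (hX.aemeasurable g₀) hUm).1 hind,
    Measure.prod_apply_symm hTm]
  have hn1 : σ₁ ^ 2 ≤ ((‖g₀‖₊ ^ 2 : ℝ≥0) : ℝ) := by
    push_cast
    gcongr
  have hn2 : ((‖g₀‖₊ ^ 2 : ℝ≥0) : ℝ) ≤ σ₂ ^ 2 := by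
    push_cast
    gcongr
  calc ∫⁻ u, (P.map (X g₀)) ((fun x => (x, u)) ⁻¹' T) ∂(P.map U)
      ≤ ∫⁻ u, ENNReal.ofReal C₁ * u ∂(P.map U) := by
        refine lintegral_mono fun u => ?_
        rw [hX.map_eq]
        exact hC₁' _ hn1 hn2 z u
    _ = ENNReal.ofReal C₁ * ∫⁻ ω, U ω ∂P := by
        rw [lintegral_const_mul _ measurable_id', lintegral_map' (by fun_prop) hUm]
    _ ≤ ENNReal.ofReal C₁ * (ENNReal.ofReal a + ENNReal.ofReal (|C₀| * s)) := by
        gcongr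
        rw [hU, lintegral_add_left' (by fun_prop), lintegral_const, measure_univ, mul_one]
        gcongr
        exact hSint.trans (ENNReal.ofReal_le_ofReal (by gcongr; exact le_abs_self _))
    _ = ENNReal.ofReal (C₁ * (1 + 1 / σ₁ + |C₀|) * s) := by
        rw [← ENNReal.ofReal_add ha0 (by positivity), ← ENNReal.ofReal_mul hC₁.le, ha]
        congr 1
        ring

/-! ### Chaining bound for expected suprema. -/

/-- Truncation at level `l`: above it, `(|x| / l) ^ q ≥ 1`. This trades a maximum for a sum of high
moments. -/
theorem enorm_le_add_pow_div (x : ℝ) {l : ℝ} (hl : 0 < l) (q : ℕ) :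
    ‖x‖ₑ ≤ ENNReal.ofReal l + ENNReal.ofReal (l⁻¹ ^ q) * ‖x‖ₑ ^ (q + 1) := by
  rw [Real.enorm_eq_ofReal_abs, ← ENNReal.ofReal_pow (abs_nonneg x),
    ← ENNReal.ofReal_mul (by positivity), ← ENNReal.ofReal_add hl.le (by positivity)]
  refine ENNReal.ofReal_le_ofReal ?_
  rcases le_or_gt |x| l with h | h
  · have : 0 ≤ l⁻¹ ^ q * |x| ^ (q + 1) := by positivity
    linarith
  · have h1 : 1 ≤ l⁻¹ * |x| := by
      rw [inv_mul_eq_div, le_div_iff₀ hl]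
      linarith
    have h2 : |x| ≤ (l⁻¹ * |x|) ^ q * |x| := le_mul_of_one_le_left (abs_nonneg x) (one_le_pow₀ h1)
    calc |x| ≤ (l⁻¹ * |x|) ^ q * |x| := h2
      _ = l⁻¹ ^ q * |x| ^ (q + 1) := by ring
      _ ≤ _ := by linarith

namespace IsIsonormal

variable {Ω H : Type*} [MeasurableSpace Ω] {P : Measure Ω}
  [NormedAddCommGroup H] [InnerProductSpace ℝ H] {X : H → Ω → ℝ}

theorem lintegral_iSup_enorm_le (hX : IsIsonormal X P) {ι : Type*} [Fintype ι] (h : ι → H)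
    {s l : ℝ} (hs : ∀ i, ‖h i‖ ≤ s) (hl : 0 < l) (q : ℕ) :
    ∫⁻ ω, ⨆ i, ‖X (h i) ω‖ₑ ∂P ≤ ENNReal.ofReal l +
      Fintype.card ι * (ENNReal.ofReal (l⁻¹ ^ q) * (ENNReal.ofReal s ^ (q + 1) *
        ∫⁻ x, ‖x‖ₑ ^ (q + 1) ∂gaussianReal 0 1)) := by
  have := hX.isGaussianProcess.isProbabilityMeasure
  calc ∫⁻ ω, ⨆ i, ‖X (h i) ω‖ₑ ∂P
      ≤ ∫⁻ ω, (ENNReal.ofReal l +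
          ∑ i, ENNReal.ofReal (l⁻¹ ^ q) * ‖X (h i) ω‖ₑ ^ (q + 1)) ∂P := by
        refine lintegral_mono fun ω => iSup_le fun i => ?_
        refine (enorm_le_add_pow_div _ hl q).trans ?_
        gcongr
        exact Finset.single_le_sum
          (f := fun i => ENNReal.ofReal (l⁻¹ ^ q) * ‖X (h i) ω‖ₑ ^ (q + 1))
          (fun _ _ => zero_le) (Finset.mem_univ i)
    _ = ENNReal.ofReal l + ∑ i, ENNReal.ofReal (l⁻¹ ^ q) * (‖h i‖ₑ ^ (q + 1) *
          ∫⁻ x, ‖x‖ₑ ^ (q + 1) ∂gaussianReal 0 1) := by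
        have hm : ∀ i, AEMeasurable (fun ω => ‖X (h i) ω‖ₑ ^ (q + 1)) P := fun i =>
          (hX.aemeasurable (h i)).enorm.pow_const _
        rw [lintegral_add_left' (by fun_prop), lintegral_const, measure_univ, mul_one,
          lintegral_finsetSum' _ (fun i _ => (hm i).const_mul _)]
        congr 1
        refine Finset.sum_congr rfl fun i _ => ?_
        rw [lintegral_const_mul'' _ (hm i), hX.lintegral_enorm_pow]
    _ ≤ ENNReal.ofReal l + ∑ _i : ι, ENNReal.ofReal (l⁻¹ ^ q) * (ENNReal.ofReal s ^ (q + 1) *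
          ∫⁻ x, ‖x‖ₑ ^ (q + 1) ∂gaussianReal 0 1) := by
        gcongr with i
        rw [← ofReal_norm]
        exact ENNReal.ofReal_le_ofReal (hs i)
    _ = _ := by
        rw [Finset.sum_const, nsmul_eq_mul, Finset.card_univ]

/-- Telescoping along the ancestors of a point down to level `0`, where the process vanishes almost
surely. -/
theorem ae_iSup_enorm_le_tsum (hX : IsIsonormal X P) {ι : ℕ → Type*} [∀ n, Countable (ι n)]
    (π : ∀ n, ι (n + 1) → ι n) (h : ∀ n, ι n → H) (h0 : ∀ i, h 0 i = 0) :
    ∀ᵐ ω ∂P, ∀ n i, ‖X (h n i) ω‖ₑ ≤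
      ∑' m, ⨆ j : ι (m + 1), ‖X (h (m + 1) j - h m (π m j)) ω‖ₑ := by
  have hsub : ∀ᵐ ω ∂P, ∀ m (j : ι (m + 1)), X (h (m + 1) j - h m (π m j)) ω =
      X (h (m + 1) j) ω - X (h m (π m j)) ω := by
    simp_rw [ae_all_iff]
    exact fun m j => hX.map_sub_ae _ _
  filter_upwards [hsub, hX.map_zero_ae] with ω hω hω0 n i
  have key : ∀ n (i : ι n), ‖X (h n i) ω‖ₑ ≤
      ∑ m ∈ Finset.range n, ⨆ j : ι (m + 1), ‖X (h (m + 1) j - h m (π m j)) ω‖ₑ := by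
    intro n
    induction n with
    | zero => intro i; simp [h0, hω0]
    | succ n ih =>
      intro i
      rw [Finset.sum_range_succ]
      have e : X (h (n + 1) i) ω = X (h n (π n i)) ω + X (h (n + 1) i - h n (π n i)) ω := by
        rw [hω]; ring
      calc ‖X (h (n + 1) i) ω‖ₑ
          ≤ ‖X (h n (π n i)) ω‖ₑ + ‖X (h (n + 1) i - h n (π n i)) ω‖ₑ := by
            rw [e]; exact enorm_add_le _ _
        _ ≤ _ := by
            gcongr
            · exact ih _
            · exact le_iSup (fun j => ‖X (h (n + 1) j - h n (π n j)) ω‖ₑ) i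
  exact (key n i).trans (ENNReal.sum_le_tsum _)

end IsIsonormal

/-- Chaining: if the `n`-th level has at most `N ^ n` points and consecutive levels are at distance
at most `s θ ^ (2 n)`, then the expected supremum is `O(s)`. -/
theorem exists_chaining_const {θ : ℝ} (hθ0 : 0 < θ) (hθ1 : θ < 1) (N : ℕ) :
    ∃ C : ℝ, 0 < C ∧ ∀ {H : Type*} [NormedAddCommGroup H] [InnerProductSpace ℝ H]
      (Ω : Type u) [MeasurableSpace Ω] (P : Measure Ω) (X : H → Ω → ℝ), IsIsonormal X P →
      ∀ (ι : ℕ → Type) [∀ n, Fintype (ι n)] (π : ∀ n, ι (n + 1) → ι n) (h : ∀ n, ι n → H) (s : ℝ),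
      0 < s → (∀ n, Fintype.card (ι n) ≤ N ^ n) → (∀ i, h 0 i = 0) →
      (∀ n (i : ι (n + 1)), ‖h (n + 1) i - h n (π n i)‖ ≤ s * θ ^ (2 * n)) →
      ∫⁻ ω, ⨆ p : (n : ℕ) × ι n, ‖X (h p.1 p.2) ω‖ₑ ∂P ≤ ENNReal.ofReal (C * s) := by
  -- A moment high enough for its gain `θ ^ q` per level to beat the growth factor `N` of the number
  -- of points.
  obtain ⟨q, hq⟩ : ∃ q : ℕ, θ ^ q * N ≤ 1 := by
    obtain ⟨q, hq⟩ := exists_pow_lt_of_lt_one (show (0 : ℝ) < ((N : ℝ) + 1)⁻¹ by positivity) hθ1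
    refine ⟨q, ?_⟩
    calc θ ^ q * N ≤ ((N : ℝ) + 1)⁻¹ * (N + 1) := by gcongr; linarith
      _ = 1 := inv_mul_cancel₀ (by positivity)
  obtain ⟨M, hM0, hM⟩ : ∃ M : ℝ, 0 ≤ M ∧
      ∫⁻ x, ‖x‖ₑ ^ (q + 1) ∂gaussianReal 0 1 = ENNReal.ofReal M :=
    ⟨_, ENNReal.toReal_nonneg,
      (ENNReal.ofReal_toReal (lintegral_enorm_pow_gaussianReal_lt_top (q + 1)).ne).symm⟩
  have h1θ : 0 < 1 - θ := by linarith
  refine ⟨(1 + N * M) * (1 - θ)⁻¹, by positivity, ?_⟩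
  intro H _ _ Ω _ P X hX ι _ π h s hs hcard h0 hstep
  have hstep' : ∀ m, ∫⁻ ω, ⨆ j : ι (m + 1), ‖X (h (m + 1) j - h m (π m j)) ω‖ₑ ∂P ≤
      ENNReal.ofReal (s * (1 + N * M) * θ ^ m) := by
    intro m
    -- The threshold `s * θ ^ m` is summable in `m`, yet exceeds the increment size `s * θ ^ (2 *
    -- m)` by `θ ^ (-m)`; this ratio produces the gain `(θ ^ q) ^ m`.
    have hl : 0 < s * θ ^ m := by positivity
    refine (hX.lintegral_iSup_enorm_le _ (hstep m) hl q).trans ?_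
    rw [hM, ← ENNReal.ofReal_pow (by positivity), ← ENNReal.ofReal_mul (by positivity),
      ← ENNReal.ofReal_mul (by positivity), ← ENNReal.ofReal_natCast,
      ← ENNReal.ofReal_mul (by positivity), ← ENNReal.ofReal_add hl.le (by positivity)]
    refine ENNReal.ofReal_le_ofReal ?_
    have hc : (Fintype.card (ι (m + 1)) : ℝ) ≤ (N : ℝ) ^ (m + 1) := by exact_mod_cast hcard (m + 1)
    have e1 : (s * θ ^ m)⁻¹ ^ q * ((s * θ ^ (2 * m)) ^ (q + 1) * M) =
        s * M * ((θ ^ q) ^ m * θ ^ m * θ ^ m) := by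
      calc (s * θ ^ m)⁻¹ ^ q * ((s * θ ^ (2 * m)) ^ (q + 1) * M)
          = ((s * θ ^ m)⁻¹ * (s * θ ^ m)) ^ q * (s * M * ((θ ^ q) ^ m * θ ^ m * θ ^ m)) := by ring
        _ = _ := by rw [inv_mul_cancel₀ hl.ne', one_pow, one_mul]
    have h2 : (θ ^ q) ^ m * (N : ℝ) ^ m ≤ 1 := by
      rw [← mul_pow]
      exact pow_le_one₀ (by positivity) hq
    have h3 : θ ^ m ≤ 1 := pow_le_one₀ hθ0.le hθ1.le
    calc s * θ ^ m + Fintype.card (ι (m + 1)) *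
          ((s * θ ^ m)⁻¹ ^ q * ((s * θ ^ (2 * m)) ^ (q + 1) * M))
        ≤ s * θ ^ m + (N : ℝ) ^ (m + 1) * (s * M * ((θ ^ q) ^ m * θ ^ m * θ ^ m)) := by
          rw [e1]
          gcongr
      _ = s * θ ^ m + s * N * M * θ ^ m * (((θ ^ q) ^ m * (N : ℝ) ^ m) * θ ^ m) := by ring
      _ ≤ s * θ ^ m + s * N * M * θ ^ m * (1 * 1) := by gcongr
      _ = s * (1 + N * M) * θ ^ m := by ring
  calc ∫⁻ ω, ⨆ p : (n : ℕ) × ι n, ‖X (h p.1 p.2) ω‖ₑ ∂P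
      ≤ ∫⁻ ω, ∑' m, ⨆ j : ι (m + 1), ‖X (h (m + 1) j - h m (π m j)) ω‖ₑ ∂P := by
        refine lintegral_mono_ae ?_
        filter_upwards [hX.ae_iSup_enorm_le_tsum π h h0] with ω hω
        exact iSup_le fun p => hω p.1 p.2
    _ = ∑' m, ∫⁻ ω, ⨆ j : ι (m + 1), ‖X (h (m + 1) j - h m (π m j)) ω‖ₑ ∂P :=
        lintegral_tsum fun m => AEMeasurable.iSup fun j => (hX.aemeasurable _).enorm
    _ ≤ ∑' m, ENNReal.ofReal (s * (1 + N * M) * θ ^ m) := ENNReal.tsum_le_tsum hstep'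
    _ = ENNReal.ofReal ((1 + N * M) * (1 - θ)⁻¹ * s) := by
        rw [← ENNReal.ofReal_tsum_of_nonneg (fun m => by positivity)
          ((summable_geometric_of_lt_one hθ0.le hθ1).mul_left _), tsum_mul_left,
          tsum_geometric_of_lt_one hθ0.le hθ1]
        congr 1
        ring

/-! ### Increments of the logarithm and of the inverse. -/

section Pointwise

/-- For `a ≤ b`, apply `log y ≤ y - 1` to `y = (b / a) ^ β` and use subadditivity of `t ↦ t ^ β`.
The symmetric right-hand side has only power singularities, square integrable in the plane when `β <
1`. -/
theorem abs_log_sub_log_le {a b h β : ℝ} (ha : 0 < a) (hb : 0 < b) (hab : |a - b| ≤ h)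
    (hβ0 : 0 < β) (hβ1 : β ≤ 1) :
    |Real.log a - Real.log b| ≤ β⁻¹ * h ^ β * (a ^ (-β) + b ^ (-β)) := by
  wlog hle : a ≤ b generalizing a b
  · rw [abs_sub_comm, add_comm]
    exact this hb ha (by rwa [abs_sub_comm]) (le_of_not_ge hle)
  have hh : 0 ≤ h := (abs_nonneg _).trans hab
  have hba : b ≤ a + h := by linarith [(abs_le.1 hab).1]
  have h1 : b / a ≤ 1 + h / a := by
    rw [div_le_iff₀ ha, add_mul, div_mul_cancel₀ _ ha.ne']
    linarith
  have h2 : Real.log (b / a) ≤ β⁻¹ * (h / a) ^ β := by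
    have h3 : (b / a) ^ β ≤ 1 + (h / a) ^ β := by
      calc (b / a) ^ β ≤ (1 + h / a) ^ β := by gcongr
        _ ≤ 1 ^ β + (h / a) ^ β :=
          Real.rpow_add_le_add_rpow zero_le_one (by positivity) hβ0.le hβ1
        _ = 1 + (h / a) ^ β := by rw [Real.one_rpow]
    have h4 : β * Real.log (b / a) ≤ (h / a) ^ β := by
      rw [← Real.log_rpow (by positivity)]
      have := Real.log_le_sub_one_of_pos (show 0 < (b / a) ^ β by positivity)
      linarith
    rw [inv_mul_eq_div, le_div_iff₀ hβ0]
    linarith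
  rw [abs_sub_comm, ← Real.log_div hb.ne' ha.ne',
    abs_of_nonneg (Real.log_nonneg ((one_le_div ha).2 hle))]
  refine h2.trans ?_
  rw [Real.div_rpow hh ha.le, Real.rpow_neg ha.le, mul_assoc, div_eq_mul_inv]
  gcongr
  have : 0 ≤ b ^ (-β) := by positivity
  linarith

/-- Both entries of the minimum are needed in `ℝ³`: `‖w‖⁻¹` is not square integrable at infinity,
nor `‖w‖⁻¹ ^ 2` at the origin. -/
theorem abs_inv_sub_inv_le_min {a b h : ℝ} (ha : 0 < a) (hb : 0 < b) (hab : |a - b| ≤ h) :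
    |a⁻¹ - b⁻¹| ≤ min a⁻¹ (h * a⁻¹ ^ 2) + min b⁻¹ (h * b⁻¹ ^ 2) := by
  wlog hle : a ≤ b generalizing a b
  · rw [abs_sub_comm, add_comm]
    exact this hb ha (by rwa [abs_sub_comm]) (le_of_not_ge hle)
  have hh : 0 ≤ h := (abs_nonneg _).trans hab
  have hba : b - a ≤ h := by linarith [(abs_le.1 hab).1]
  have hinv : b⁻¹ ≤ a⁻¹ := by gcongr
  rw [abs_of_nonneg (by linarith)]
  have h0 : 0 ≤ min b⁻¹ (h * b⁻¹ ^ 2) := by positivity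
  have hb' : 0 < b⁻¹ := by positivity
  have h1 : a⁻¹ - b⁻¹ ≤ h * a⁻¹ ^ 2 := by
    have : a⁻¹ - b⁻¹ = (b - a) * (a⁻¹ * b⁻¹) := by field_simp
    rw [this, sq]
    gcongr
  have := le_min (show a⁻¹ - b⁻¹ ≤ a⁻¹ by linarith) h1
  linarith

end Pointwise

/-! ### `L²` norms of radial singularities. -/

section Radial

variable {k : ℕ}

theorem memLp_indicator_norm_rpow (hk : 1 ≤ k) {β : ℝ} (hβ : 2 * β < k) (r : ℝ) :
    MemLp ((Metric.ball (0 : Euc k) r).indicator fun y => ‖y‖ ^ (-β)) 2 volume := by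
  have hm : Measurable fun y : Euc k => ‖y‖ ^ (-β) := by fun_prop
  rw [memLp_two_iff_integrable_sq (hm.indicator measurableSet_ball).aestronglyMeasurable]
  have e : (fun y : Euc k => ((Metric.ball (0 : Euc k) r).indicator (fun y => ‖y‖ ^ (-β)) y) ^ 2) =
      (Metric.ball (0 : Euc k) r).indicator fun y => (‖y‖ ^ (-β)) ^ 2 := by
    ext y
    by_cases hy : y ∈ Metric.ball (0 : Euc k) r <;> simp [hy]
  rw [e, integrable_indicator_iff measurableSet_ball]
  refine integrableOn_ball_of_norm_le_rpow (C := 1) (α := 2 * β) (by simpa using hk)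
    (by simpa using hβ) (Filter.Eventually.of_forall fun y => ?_)
    (hm.pow_const 2).aestronglyMeasurable
  rw [Real.norm_of_nonneg (by positivity), one_mul, ← Real.rpow_mul_natCast (norm_nonneg _)]
  apply le_of_eq
  congr 1
  push_cast
  ring

theorem exists_eLpNorm_norm_sub_rpow_le (hk : 1 ≤ k) {β : ℝ} (hβ : 2 * β < k) :
    ∃ C : ℝ, 0 ≤ C ∧ ∀ x ∈ Metric.ball (0 : Euc k) 1,
      eLpNorm (fun y => ‖x - y‖ ^ (-β)) 2 (volume.restrict (Metric.ball (0 : Euc k) 1)) ≤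
        ENNReal.ofReal C := by
  -- Differences of points of the unit ball have norm below `2`, so after translation one fixed
  -- function serves all `x`.
  have hF := memLp_indicator_norm_rpow hk hβ 2
  refine ⟨(eLpNorm ((Metric.ball (0 : Euc k) 2).indicator fun y => ‖y‖ ^ (-β)) 2 volume).toReal,
    ENNReal.toReal_nonneg, fun x hx => ?_⟩
  rw [ENNReal.ofReal_toReal hF.2.ne, ← eLpNorm_comp_measurePreserving hF.1
    (Measure.measurePreserving_sub_left volume x)]
  refine le_trans (eLpNorm_mono_ae ?_) (eLpNorm_mono_measure _ Measure.restrict_le_self)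
  filter_upwards [ae_restrict_mem measurableSet_ball] with y hy
  rw [Function.comp_apply, indicator_of_mem]
  rw [mem_ball_zero_iff] at *
  linarith [norm_sub_le x y]

theorem memLp_min_inv :
    MemLp (fun w : Euc 3 => min ‖w‖⁻¹ (‖w‖⁻¹ ^ 2)) 2 volume := by
  have hm : Measurable fun w : Euc 3 => min ‖w‖⁻¹ (‖w‖⁻¹ ^ 2) := by fun_prop
  rw [memLp_two_iff_integrable_sq hm.aestronglyMeasurable]
  have h1 : Integrable ((Metric.ball (0 : Euc 3) 1).indicator fun w => ‖w‖⁻¹ ^ 2) volume := by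
    rw [integrable_indicator_iff measurableSet_ball]
    refine integrableOn_ball_of_norm_le_rpow (C := 1) (α := 2) (by simp)
      (by simp; norm_num) (Filter.Eventually.of_forall fun y => ?_)
      (Measurable.aestronglyMeasurable (by fun_prop))
    rw [Real.norm_of_nonneg (by positivity), one_mul, Real.rpow_neg (norm_nonneg _), inv_pow]
    norm_cast
  have h2 : Integrable (fun w : Euc 3 => 16 * (1 + ‖w‖) ^ (-(4 : ℝ))) volume :=
    (integrable_one_add_norm (by simp; norm_num)).const_mul _
  refine (h1.add h2).mono' (hm.pow_const 2).aestronglyMeasurable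
    (Filter.Eventually.of_forall fun w => ?_)
  rw [Real.norm_of_nonneg (by positivity), Pi.add_apply]
  by_cases hw : w ∈ Metric.ball (0 : Euc 3) 1
  · rw [indicator_of_mem hw]
    have : 0 ≤ 16 * (1 + ‖w‖) ^ (-(4 : ℝ)) := by positivity
    have h3 : min ‖w‖⁻¹ (‖w‖⁻¹ ^ 2) ^ 2 ≤ ‖w‖⁻¹ ^ 2 := by
      gcongr
      exact min_le_left _ _
    linarith
  · rw [indicator_of_notMem hw, zero_add]
    have hw1 : 1 ≤ ‖w‖ := by simpa using hw
    calc min ‖w‖⁻¹ (‖w‖⁻¹ ^ 2) ^ 2 ≤ (‖w‖⁻¹ ^ 2) ^ 2 := by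
          gcongr
          exact min_le_right _ _
      _ = 16 * ((2 * ‖w‖) ^ 4)⁻¹ := by
          field_simp
          norm_num
      _ ≤ 16 * ((1 + ‖w‖) ^ 4)⁻¹ := by
          gcongr
          linarith
      _ = 16 * (1 + ‖w‖) ^ (-(4 : ℝ)) := by
          rw [Real.rpow_neg (by positivity)]
          norm_cast

/-- The function is `h⁻¹` times a dilate of its `h = 1` version, and dilation contributes `h ^ (3 /
2)`. This gives the exponent `ξ = 1/2` without loss when `k = 3`. -/
theorem eLpNorm_min_inv_scaled {h : ℝ} (hh : 0 < h) :
    eLpNorm (fun w : Euc 3 => min ‖w‖⁻¹ (h * ‖w‖⁻¹ ^ 2)) 2 volume =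
      ENNReal.ofReal (h ^ (1 / 2 : ℝ)) *
        eLpNorm (fun w : Euc 3 => min ‖w‖⁻¹ (‖w‖⁻¹ ^ 2)) 2 volume := by
  set ψ := fun w : Euc 3 => min ‖w‖⁻¹ (‖w‖⁻¹ ^ 2) with hψ
  have e : (fun w : Euc 3 => min ‖w‖⁻¹ (h * ‖w‖⁻¹ ^ 2)) = h⁻¹ • (ψ ∘ fun w => h⁻¹ • w) := by
    ext w
    have hw : ‖h⁻¹ • w‖⁻¹ = h * ‖w‖⁻¹ := by
      rw [norm_smul, Real.norm_of_nonneg (by positivity), mul_inv, inv_inv]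
    simp only [Pi.smul_apply, Function.comp_apply, hψ, hw, smul_eq_mul]
    rw [mul_min_of_nonneg _ _ (by positivity)]
    congr 1 <;> field_simp
  have hm : AEStronglyMeasurable ψ (Measure.map (fun w : Euc 3 => h⁻¹ • w) volume) :=
    Measurable.aestronglyMeasurable (by fun_prop)
  rw [e, eLpNorm_const_smul, ← eLpNorm_map_measure hm (by fun_prop),
    Measure.map_addHaar_smul _ (by positivity), eLpNorm_smul_measure_of_ne_top (by simp),
    smul_eq_mul, ← mul_assoc]
  congr 1
  rw [Real.enorm_eq_ofReal (by positivity), ENNReal.ofReal_rpow_of_nonneg (by positivity) (by simp),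
    ← ENNReal.ofReal_mul (by positivity)]
  congr 1
  have h1 : |((h⁻¹ ^ Module.finrank ℝ (Euc 3)))⁻¹| = h ^ (3 : ℝ) := by
    rw [abs_of_nonneg (by positivity)]
    simp only [finrank_euclideanSpace, Fintype.card_fin, inv_pow, inv_inv]
    norm_cast
  rw [h1, ← Real.rpow_mul hh.le, ← Real.rpow_neg_one, ← Real.rpow_add hh]
  norm_num

end Radial

/-! ### Regularity of the fundamental solution. -/

section FundSol

variable {k : ℕ}

instance isFiniteMeasure_restrict_ball (x : Euc k) (r : ℝ) :
    IsFiniteMeasure (volume.restrict (Metric.ball x r)) :=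
  ⟨by simpa using measure_ball_lt_top⟩

@[fun_prop]
theorem measurable_fundSol (k : ℕ) : Measurable (fundSol k) := by
  unfold fundSol
  split_ifs <;> fun_prop

theorem ae_pos_norm_sub (hk : k = 2 ∨ k = 3) (x : Euc k) (μ : Measure (Euc k))
    (hμ : μ ≪ volume) : ∀ᵐ y ∂μ, 0 < ‖x - y‖ := by
  have : Nontrivial (Euc k) := by
    rcases hk with rfl | rfl <;> infer_instance
  refine hμ.ae_le ?_
  filter_upwards [compl_mem_ae_iff.2 (measure_singleton x)] with y hy
  exact norm_pos_iff.2 (sub_ne_zero.2 fun h => hy h.symm)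

theorem abs_sub_norm_sub_le (x x' y : Euc k) : |‖x - y‖ - ‖x' - y‖| ≤ ‖x - x'‖ := by
  simpa using abs_norm_sub_norm_le (x - y) (x' - y)

theorem memLp_norm_sub_rpow (hk : 1 ≤ k) {β : ℝ} (hβ : 2 * β < k) {x : Euc k}
    (hx : x ∈ Metric.ball (0 : Euc k) 1) :
    MemLp (fun y => ‖x - y‖ ^ (-β)) 2 (volume.restrict (Metric.ball (0 : Euc k) 1)) := by
  obtain ⟨C, -, hC⟩ := exists_eLpNorm_norm_sub_rpow_le hk hβ
  exact ⟨Measurable.aestronglyMeasurable (by fun_prop), (hC x hx).trans_lt ENNReal.ofReal_lt_top⟩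

theorem memLp_fundSol_norm_sub (hk : k = 2 ∨ k = 3) {x : Euc k}
    (hx : x ∈ Metric.ball (0 : Euc k) 1) :
    MemLp (fun y => fundSol k ‖x - y‖) 2 (volume.restrict (Metric.ball (0 : Euc k) 1)) := by
  have hm : Measurable fun y : Euc k => fundSol k ‖x - y‖ :=
    (measurable_fundSol k).comp (by fun_prop)
  have hpos := ae_pos_norm_sub hk x (volume.restrict (Metric.ball (0 : Euc k) 1))
    Measure.restrict_le_self.absolutelyContinuous
  rcases hk with rfl | rfl
  · have h1 := memLp_norm_sub_rpow (β := 1 / 2) (by norm_num) (by norm_num) hx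
    have h2 : MemLp (fun y : Euc 2 => 1 / (2 * Real.pi) *
        ((1 / 2 : ℝ)⁻¹ * 2 ^ (1 / 2 : ℝ) * (‖x - y‖ ^ (-(1 / 2 : ℝ)) + 2 ^ (-(1 / 2 : ℝ))) +
          Real.log 2)) 2 (volume.restrict (Metric.ball (0 : Euc 2) 1)) :=
      (((h1.add (memLp_const _)).const_mul _).add (memLp_const _)).const_mul _
    refine h2.mono' hm.aestronglyMeasurable ?_
    filter_upwards [hpos, ae_restrict_mem measurableSet_ball] with y hy hyD
    rw [mem_ball_zero_iff] at *
    have hle : ‖x - y‖ ≤ 2 := by linarith [norm_sub_le x y]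
    have h3 := abs_log_sub_log_le (h := 2) (β := 1 / 2) hy two_pos
      (by rw [abs_le]; constructor <;> linarith) (by norm_num) (by norm_num)
    have h4 : |Real.log ‖x - y‖| ≤ |Real.log ‖x - y‖ - Real.log 2| + Real.log 2 := by
      have := abs_sub_abs_le_abs_sub (Real.log ‖x - y‖) (Real.log 2)
      rw [abs_of_pos (Real.log_pos one_lt_two)] at this
      linarith
    simp only [fundSol, if_true, norm_mul, Real.norm_eq_abs]
    rw [abs_of_pos (show 0 < 1 / (2 * Real.pi) by positivity)]
    gcongr
    linarith
  · have h1 := (memLp_norm_sub_rpow (β := 1) (by norm_num) (by norm_num) hx).const_mul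
      (1 / (4 * Real.pi))
    convert! h1 using 2 with y
    simp [fundSol, Real.rpow_neg_one]

/-- For `k = 2` the logarithmic bound is used with `β = 1 - γ`, and `γ > 0` is what makes `‖·‖ ^
(-β)` locally square integrable. For `k = 3` the scaling identity applies. -/
theorem exists_eLpNorm_fundSol_sub_le (hk : k = 2 ∨ k = 3) {γ : ℝ} (hγ0 : 0 < γ) (hγ1 : γ < 1) :
    ∃ C : ℝ, 0 ≤ C ∧ ∀ x ∈ Metric.ball (0 : Euc k) 1, ∀ x' ∈ Metric.ball (0 : Euc k) 1,
      eLpNorm (fun y => fundSol k ‖x - y‖ - fundSol k ‖x' - y‖) 2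
        (volume.restrict (Metric.ball (0 : Euc k) 1)) ≤ ENNReal.ofReal (C * ‖x - x'‖ ^ xi k γ) := by
  have hpos := fun x => ae_pos_norm_sub hk x (volume.restrict (Metric.ball (0 : Euc k) 1))
    Measure.restrict_le_self.absolutelyContinuous
  have hpi := Real.pi_pos
  rcases hk with rfl | rfl
  · obtain ⟨C, hC0, hC⟩ := exists_eLpNorm_norm_sub_rpow_le (k := 2) (β := 1 - γ) (by norm_num)
      (by push_cast; linarith)
    have hβ : 0 < 1 - γ := by linarith
    refine ⟨1 / (2 * Real.pi) * (1 - γ)⁻¹ * (2 * C), by positivity, fun x hx x' hx' => ?_⟩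
    set h := ‖x - x'‖ with hh
    have hxi : xi 2 γ = 1 - γ := by simp [xi]
    rw [hxi]
    set c := 1 / (2 * Real.pi) * (1 - γ)⁻¹ * h ^ (1 - γ) with hc
    have hc0 : 0 ≤ c := by positivity
    have hm : ∀ z : Euc 2, AEStronglyMeasurable (fun y => ‖z - y‖ ^ (-(1 - γ)))
        (volume.restrict (Metric.ball (0 : Euc 2) 1)) := fun z =>
      Measurable.aestronglyMeasurable (by fun_prop)
    calc _ ≤ eLpNorm (c • ((fun y => ‖x - y‖ ^ (-(1 - γ))) + fun y => ‖x' - y‖ ^ (-(1 - γ)))) 2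
          (volume.restrict (Metric.ball (0 : Euc 2) 1)) := by
          refine eLpNorm_mono_ae ?_
          filter_upwards [hpos x, hpos x'] with y hy hy'
          have h1 := abs_log_sub_log_le hy hy' (abs_sub_norm_sub_le x x' y) hβ (by linarith)
          simp only [fundSol, if_true, Pi.smul_apply, Pi.add_apply, smul_eq_mul]
          rw [← mul_sub, Real.norm_eq_abs, abs_mul, Real.norm_of_nonneg (by positivity), hc,
            abs_of_pos (show 0 < 1 / (2 * Real.pi) by positivity), mul_assoc, mul_assoc]
          gcongr
          rw [← mul_assoc]
          exact h1
      _ ≤ ENNReal.ofReal c * (ENNReal.ofReal C + ENNReal.ofReal C) := by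
          rw [eLpNorm_const_smul, Real.enorm_eq_ofReal hc0]
          gcongr
          exact (eLpNorm_add_le (hm x) (hm x') (by norm_num)).trans (add_le_add (hC x hx) (hC x' hx'))
      _ = _ := by
          rw [← ENNReal.ofReal_add hC0 hC0, ← ENNReal.ofReal_mul hc0, hc]
          congr 1
          ring
  · set ψ := eLpNorm (fun w : Euc 3 => min ‖w‖⁻¹ (‖w‖⁻¹ ^ 2)) 2 volume with hψ
    obtain ⟨C, hC0, hC⟩ : ∃ C : ℝ, 0 ≤ C ∧ ψ = ENNReal.ofReal C :=
      ⟨_, ENNReal.toReal_nonneg, (ENNReal.ofReal_toReal memLp_min_inv.2.ne).symm⟩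
    refine ⟨1 / (4 * Real.pi) * (2 * C), by positivity, fun x hx x' hx' => ?_⟩
    have hxi : xi 3 γ = 1 / 2 := by simp [xi]
    rw [hxi]
    rcases eq_or_ne x x' with rfl | hne
    · simp
    set h := ‖x - x'‖ with hh
    have h0 : 0 < h := norm_pos_iff.2 (sub_ne_zero.2 hne)
    set ψh := fun w : Euc 3 => min ‖w‖⁻¹ (h * ‖w‖⁻¹ ^ 2) with hψh
    have hψm : Measurable ψh := by fun_prop
    have hm : ∀ z : Euc 3, AEStronglyMeasurable (fun y => ψh (z - y))
        (volume.restrict (Metric.ball (0 : Euc 3) 1)) := fun z =>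
      (hψm.comp (by fun_prop)).aestronglyMeasurable
    have hbd : ∀ z : Euc 3, eLpNorm (fun y => ψh (z - y)) 2
        (volume.restrict (Metric.ball (0 : Euc 3) 1)) ≤ ENNReal.ofReal (h ^ (1 / 2 : ℝ) * C) := by
      intro z
      refine (eLpNorm_mono_measure _ Measure.restrict_le_self).trans (le_of_eq ?_)
      have := eLpNorm_comp_measurePreserving (p := 2) hψm.aestronglyMeasurable
        (Measure.measurePreserving_sub_left volume z)
      rw [ENNReal.ofReal_mul (by positivity), ← hC, hψ, ← eLpNorm_min_inv_scaled h0]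
      exact this
    have hc0 : 0 < 1 / (4 * Real.pi) := by positivity
    calc _ ≤ eLpNorm ((1 / (4 * Real.pi)) • ((fun y => ψh (x - y)) + fun y => ψh (x' - y))) 2
          (volume.restrict (Metric.ball (0 : Euc 3) 1)) := by
          refine eLpNorm_mono_ae ?_
          filter_upwards [hpos x, hpos x'] with y hy hy'
          have h1 := abs_inv_sub_inv_le_min hy hy' (abs_sub_norm_sub_le x x' y)
          simp only [fundSol, Pi.smul_apply, Pi.add_apply, smul_eq_mul]
          rw [if_neg (by norm_num), if_neg (by norm_num), ← mul_sub, Real.norm_eq_abs, abs_mul,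
            Real.norm_of_nonneg (by positivity), abs_of_pos hc0]
          gcongr
      _ ≤ ENNReal.ofReal (1 / (4 * Real.pi)) *
            (ENNReal.ofReal (h ^ (1 / 2 : ℝ) * C) + ENNReal.ofReal (h ^ (1 / 2 : ℝ) * C)) := by
          rw [eLpNorm_const_smul, Real.enorm_eq_ofReal hc0.le]
          gcongr
          exact (eLpNorm_add_le (hm x) (hm x') (by norm_num)).trans (add_le_add (hbd x) (hbd x'))
      _ = _ := by
          rw [← ENNReal.ofReal_add (by positivity) (by positivity), ← ENNReal.ofReal_mul hc0.le]
          congr 1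
          ring

/-- Away from the singularity `fundSol` is Lipschitz; as `c ≤ 1`, the constant `c⁻¹ ^ 2` covers both
the logarithm and the inverse. -/
theorem abs_fundSol_sub_le {c : ℝ} (hc : 0 < c) (hc1 : c ≤ 1) {r r' : ℝ} (hr : c ≤ r)
    (hr' : c ≤ r') : |fundSol k r - fundSol k r'| ≤ c⁻¹ ^ 2 * |r - r'| := by
  have hr0 := hc.trans_le hr
  have hr0' := hc.trans_le hr'
  have hpi := Real.two_le_pi
  have hcc : c⁻¹ ≤ c⁻¹ ^ 2 := le_self_pow₀ ((one_le_inv₀ hc).2 hc1) two_ne_zero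
  unfold fundSol
  split_ifs
  · have h1 : |Real.log r - Real.log r'| ≤ c⁻¹ * |r - r'| := by
      wlog hle : r ≤ r' generalizing r r'
      · rw [abs_sub_comm, abs_sub_comm r]
        exact this hr' hr hr0' hr0 (le_of_not_ge hle)
      rw [abs_sub_comm, ← Real.log_div hr0'.ne' hr0.ne',
        abs_of_nonneg (Real.log_nonneg ((one_le_div hr0).2 hle)), abs_sub_comm,
        abs_of_nonneg (sub_nonneg.2 hle)]
      calc Real.log (r' / r) ≤ r' / r - 1 := Real.log_le_sub_one_of_pos (by positivity)
        _ = r⁻¹ * (r' - r) := by field_simp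
        _ ≤ c⁻¹ * (r' - r) := by
          have := sub_nonneg.2 hle
          gcongr
    rw [← mul_sub, abs_mul, abs_of_pos (by positivity)]
    calc 1 / (2 * Real.pi) * |Real.log r - Real.log r'|
        ≤ 1 * (c⁻¹ * |r - r'|) := by
          gcongr
          rw [div_le_one (by positivity)]
          linarith
      _ ≤ _ := by
          rw [one_mul]
          gcongr
  · have h1 : |r⁻¹ - r'⁻¹| ≤ c⁻¹ ^ 2 * |r - r'| := by
      have : r⁻¹ - r'⁻¹ = (r⁻¹ * r'⁻¹) * (r' - r) := by field_simp
      rw [this, abs_mul, abs_of_pos (by positivity), abs_sub_comm, sq]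
      gcongr
    rw [← mul_sub, abs_mul, abs_of_pos (by positivity)]
    calc 1 / (4 * Real.pi) * |r⁻¹ - r'⁻¹| ≤ 1 * |r⁻¹ - r'⁻¹| := by
          gcongr
          rw [div_le_one (by positivity)]
          linarith
      _ ≤ _ := by rwa [one_mul]

theorem fundSol_ne {r r' : ℝ} (hr : 0 < r) (h : r < r') : fundSol k r ≠ fundSol k r' := by
  have hpi := Real.pi_pos
  unfold fundSol
  split_ifs
  · intro he
    have := mul_left_cancel₀ (by positivity) he
    exact (Real.log_lt_log hr h).ne this
  · intro he
    have := mul_left_cancel₀ (by positivity) he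
    exact h.ne (inv_injective this)

end FundSol

/-! ### The mirror image and the regular part of the Green function. -/

section Reflection

variable {k : ℕ}

/-- The distance `|y| |x - y / |y|²|` from `x` to the mirror image of `y`, rescaled by `|y|`, and
extended to `y = 0` by continuity. -/
noncomputable def reflDist (x y : Euc k) : ℝ :=
  if y = 0 then 1 else ‖y‖ * ‖x - (‖y‖ ^ 2)⁻¹ • y‖

theorem measurable_reflDist (x : Euc k) : Measurable (reflDist x) := by
  unfold reflDist
  exact Measurable.ite (measurableSet_singleton 0) (by fun_prop) (by fun_prop)

theorem reflDist_nonneg (x y : Euc k) : 0 ≤ reflDist x y := by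
  unfold reflDist
  split_ifs <;> positivity

/-- This identity removes the apparent singularity at `y = 0` and exhibits the strict comparison
with `‖x - y‖` inside the ball. -/
theorem reflDist_sq (x y : Euc k) :
    reflDist x y ^ 2 = ‖x - y‖ ^ 2 + (1 - ‖x‖ ^ 2) * (1 - ‖y‖ ^ 2) := by
  unfold reflDist
  split_ifs with hy
  · simp [hy]
  · have hy' : ‖y‖ ≠ 0 := norm_ne_zero_iff.2 hy
    rw [mul_pow, norm_sub_sq_real, norm_sub_sq_real, inner_smul_right, norm_smul, norm_inv,
      norm_pow, norm_norm]
    field_simp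
    ring

theorem reflDist_zero_left (y : Euc k) : reflDist 0 y = 1 := by
  rw [← pow_eq_one_iff_of_nonneg (reflDist_nonneg 0 y) two_ne_zero, reflDist_sq]
  simp

theorem norm_sub_lt_reflDist {x y : Euc k} (hx : x ∈ Metric.ball (0 : Euc k) 1)
    (hy : y ∈ Metric.ball (0 : Euc k) 1) : ‖x - y‖ < reflDist x y := by
  rw [mem_ball_zero_iff] at hx hy
  refine lt_of_pow_lt_pow_left₀ 2 (reflDist_nonneg x y) ?_
  rw [reflDist_sq]
  have h1 : 0 < 1 - ‖x‖ ^ 2 := by nlinarith [norm_nonneg x]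
  have h2 : 0 < 1 - ‖y‖ ^ 2 := by nlinarith [norm_nonneg y]
  have := mul_pos h1 h2
  linarith

/-- Uses `(1 - st)² = (s - t)² + (1 - s²)(1 - t²)` with `s = ‖x‖`, `t = ‖y‖`. Hence the regular part
stays away from its singularity when `x` stays away from the boundary. -/
theorem one_sub_norm_le_reflDist {x y : Euc k} (hx : x ∈ Metric.ball (0 : Euc k) 1)
    (hy : y ∈ Metric.ball (0 : Euc k) 1) : 1 - ‖x‖ ≤ reflDist x y := by
  rw [mem_ball_zero_iff] at hx hy
  refine le_of_sq_le_sq ?_ (reflDist_nonneg x y)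
  rw [reflDist_sq]
  have h1 := abs_norm_sub_norm_le x y
  have h2 : (‖x‖ - ‖y‖) ^ 2 ≤ ‖x - y‖ ^ 2 := by
    rw [← sq_abs]
    gcongr
  have h3 : ‖x‖ * ‖y‖ ≤ ‖x‖ := by nlinarith [norm_nonneg x]
  have h4 : (1 - ‖x‖) ^ 2 ≤ (1 - ‖x‖ * ‖y‖) ^ 2 := by
    gcongr
  nlinarith

theorem abs_reflDist_sub_le (x x' : Euc k) {y : Euc k} (hy : y ∈ Metric.ball (0 : Euc k) 1) :
    |reflDist x y - reflDist x' y| ≤ ‖x - x'‖ := by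
  rw [mem_ball_zero_iff] at hy
  unfold reflDist
  split_ifs with h
  · simp
  · rw [← mul_sub, abs_mul, abs_norm]
    calc ‖y‖ * |‖x - (‖y‖ ^ 2)⁻¹ • y‖ - ‖x' - (‖y‖ ^ 2)⁻¹ • y‖|
        ≤ 1 * ‖x - x'‖ := by
          gcongr
          exact abs_sub_norm_sub_le _ _ _
      _ = _ := one_mul _

theorem green_eq (hk : k = 2 ∨ k = 3) (b : ℝ) (x y : Euc k) :
    green k b x y = fundSol k ‖x - y‖ - fundSol k (reflDist x y) := by
  rcases hk with rfl | rfl <;> by_cases hy : y = 0 <;> simp [green, reflDist, hy]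

end Reflection

/-! ### The domain and the exponent. -/

section Domain

variable {k : ℕ} {b : ℝ}

theorem domain_eq_ball (hk : k = 2 ∨ k = 3) (b : ℝ) : domain k b = Metric.ball 0 1 := by
  rcases hk with rfl | rfl <;> simp [domain]

theorem isOpen_domain (k : ℕ) (b : ℝ) : IsOpen (domain k b) := by
  unfold domain
  split_ifs
  · simp only [ofPred_forall]
    exact isOpen_iInter_of_finite fun i => isOpen_Ioo.preimage (by fun_prop)
  · exact Metric.isOpen_ball

theorem domain_one_subset (b : ℝ) : domain 1 b ⊆ Metric.ball 0 (|b| + 1) := by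
  intro x hx
  have h := hx
  simp only [domain, if_true, mem_ofPred_eq] at h
  obtain ⟨h0, h1⟩ := h 0
  rw [mem_ball_zero_iff, EuclideanSpace.norm_eq]
  simp only [Finset.univ_unique, Fin.default_eq_zero, Fin.isValue, Real.norm_eq_abs, sq_abs,
    Finset.sum_singleton]
  rw [Real.sqrt_sq h0.le]
  linarith [le_abs_self b]

theorem isBounded_domain (k : ℕ) (b : ℝ) : Bornology.IsBounded (domain k b) := by
  by_cases hk : k = 1
  · subst hk
    exact Metric.isBounded_ball.subset (domain_one_subset b)
  · simp only [domain, if_neg hk]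
    exact Metric.isBounded_ball

instance isFiniteMeasure_restrict_domain (k : ℕ) (b : ℝ) :
    IsFiniteMeasure ((volume : Measure (Euc k)).restrict (domain k b)) :=
  ⟨by simpa using (isBounded_domain k b).measure_lt_top⟩

theorem xi_pos (hk : k = 1 ∨ k = 2 ∨ k = 3) {γ : ℝ} (hγ1 : γ < 1) : 0 < xi k γ := by
  rcases hk with rfl | rfl | rfl <;> simp [xi, hγ1]

theorem xi_le_one (hk : k = 1 ∨ k = 2 ∨ k = 3) {γ : ℝ} (hγ0 : 0 < γ) : xi k γ ≤ 1 := by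
  rcases hk with rfl | rfl | rfl <;> simp [xi, hγ0.le]
  norm_num

end Domain

/-! ### The Green kernel as a Hölder, nonvanishing map into `L²(D)`. -/

section Green

variable {k : ℕ} {b : ℝ}

theorem measurable_green (hk : k = 1 ∨ k = 2 ∨ k = 3) (b : ℝ) (x : Euc k) :
    Measurable (green k b x) := by
  rcases hk with rfl | hk
  · have : green 1 b x = fun y => min (x 0) (y 0) - x 0 * y 0 / b := rfl
    rw [this]
    fun_prop
  · have : green k b x = fun y => fundSol k ‖x - y‖ - fundSol k (reflDist x y) :=
      funext (green_eq hk b x)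
    rw [this]
    exact ((measurable_fundSol k).comp (by fun_prop)).sub
      ((measurable_fundSol k).comp (measurable_reflDist x))

theorem abs_green_one_sub_le (hb : 0 < b) (x x' : Euc 1) {y : Euc 1} (hy : y ∈ domain 1 b) :
    |green 1 b x y - green 1 b x' y| ≤ 2 * ‖x - x'‖ := by
  simp only [domain, if_true, mem_ofPred_eq] at hy
  obtain ⟨h0, h1⟩ := hy 0
  have e : green 1 b x y - green 1 b x' y =
      (min (x 0) (y 0) - min (x' 0) (y 0)) - (x 0 - x' 0) * (y 0 / b) := by
    simp only [green]
    ring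
  have hn : |x 0 - x' 0| ≤ ‖x - x'‖ := by
    simpa using PiLp.norm_apply_le (x - x') 0
  have h2 : |min (x 0) (y 0) - min (x' 0) (y 0)| ≤ |x 0 - x' 0| := by
    have := abs_min_sub_min_le_max (x 0) (y 0) (x' 0) (y 0)
    simpa using this
  have h3 : |(x 0 - x' 0) * (y 0 / b)| ≤ |x 0 - x' 0| * 1 := by
    rw [abs_mul, abs_of_pos (show 0 < y 0 / b by positivity)]
    gcongr
    rw [div_le_one hb]
    exact h1.le
  rw [e]
  linarith [abs_sub (min (x 0) (y 0) - min (x' 0) (y 0)) ((x 0 - x' 0) * (y 0 / b))]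

/-- In the ball, `‖x - y‖ < reflDist x y` and `fundSol` separates distinct positive radii.
Nonvanishing, rather than positivity, accommodates the sign chosen for `k = 2`. -/
theorem green_ne_zero (hk : k = 1 ∨ k = 2 ∨ k = 3) {x y : Euc k} (hx : x ∈ domain k b)
    (hy : y ∈ domain k b) (hxy : 0 < ‖x - y‖) : green k b x y ≠ 0 := by
  rcases hk with rfl | hk
  · simp only [domain, if_true, mem_ofPred_eq] at hx hy
    obtain ⟨hx0, hx1⟩ := hx 0
    obtain ⟨hy0, hy1⟩ := hy 0
    have hb : 0 < b := hx0.trans hx1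
    refine ne_of_gt ?_
    change 0 < min (x 0) (y 0) - x 0 * y 0 / b
    rw [sub_pos, lt_min_iff, div_lt_iff₀ hb, div_lt_iff₀ hb]
    constructor <;> nlinarith
  · rw [domain_eq_ball hk] at hx hy
    rw [green_eq hk, sub_ne_zero]
    exact fundSol_ne hxy (norm_sub_lt_reflDist hx hy)

theorem memLp_green (hk : k = 1 ∨ k = 2 ∨ k = 3) (hb : 0 < b) {x : Euc k} (hx : x ∈ domain k b) :
    MemLp (green k b x) 2 ((volume : Measure (Euc k)).restrict (domain k b)) := by
  rcases hk with rfl | hk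
  · refine MemLp.of_bound (measurable_green (Or.inl rfl) b x).aestronglyMeasurable (2 * ‖x‖) ?_
    filter_upwards [ae_restrict_mem (isOpen_domain 1 b).measurableSet] with y hy
    have h := abs_green_one_sub_le hb x 0 hy
    have h0 : green 1 b 0 y = 0 := by
      simp only [domain, if_true, mem_ofPred_eq] at hy
      simp [green, (hy 0).1.le]
    simpa [h0] using h
  · have e : green k b x = (fun y => fundSol k ‖x - y‖) - fun y => fundSol k (reflDist x y) :=
      funext (green_eq hk b x)
    rw [domain_eq_ball hk] at hx ⊢
    rw [e]
    refine (memLp_fundSol_norm_sub hk hx).sub ?_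
    have hx1 : ‖x‖ < 1 := by simpa using hx
    have hc : 0 < 1 - ‖x‖ := by linarith
    refine MemLp.of_bound
      ((measurable_fundSol k).comp (measurable_reflDist x)).aestronglyMeasurable
      ((1 - ‖x‖)⁻¹ ^ 2 * ‖x‖ + |fundSol k 1|) ?_
    filter_upwards [ae_restrict_mem measurableSet_ball] with y hy
    -- Comparison with the centre, where the reflected distance is identically `1`.
    have h1 := abs_reflDist_sub_le x 0 hy
    rw [reflDist_zero_left, sub_zero] at h1
    have h2 := abs_fundSol_sub_le (k := k) hc (by linarith [norm_nonneg x])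
      (one_sub_norm_le_reflDist hx hy) (show 1 - ‖x‖ ≤ 1 by linarith [norm_nonneg x])
    have h3 := abs_sub_abs_le_abs_sub (fundSol k (reflDist x y)) (fundSol k 1)
    have h4 : (1 - ‖x‖)⁻¹ ^ 2 * |reflDist x y - 1| ≤ (1 - ‖x‖)⁻¹ ^ 2 * ‖x‖ := by gcongr
    change |fundSol k (reflDist x y)| ≤ _
    linarith

/-- For `k = 1` the kernel is Lipschitz in `x`. Otherwise the singular part is `ξ`-Hölder in `L²`,
and the regular part is Lipschitz because `K` keeps a positive distance from the sphere. -/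
theorem exists_eLpNorm_green_sub_le (hk : k = 1 ∨ k = 2 ∨ k = 3) (hb : 0 < b) {γ : ℝ}
    (hγ0 : 0 < γ) (hγ1 : γ < 1) {K : Set (Euc k)} (hK : IsCompact K) (hKD : K ⊆ domain k b) :
    ∃ L : ℝ, 0 < L ∧ ∀ x ∈ K, ∀ x' ∈ K,
      eLpNorm (green k b x - green k b x') 2 ((volume : Measure (Euc k)).restrict (domain k b)) ≤
        ENNReal.ofReal (L * ‖x - x'‖ ^ xi k γ) := by
  rcases hk with rfl | hk
  · set V := (((volume : Measure (Euc 1)).restrict (domain 1 b)) univ ^ (2 : ℝ≥0∞).toReal⁻¹) with hV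
    have hVt : V ≠ ∞ := ENNReal.rpow_ne_top_of_nonneg (by positivity) (measure_ne_top _ _)
    refine ⟨V.toReal * 2 + 1, by positivity, fun x _ x' _ => ?_⟩
    have h := eLpNorm_le_of_ae_bound (p := 2) (f := green 1 b x - green 1 b x')
      (μ := (volume : Measure (Euc 1)).restrict (domain 1 b)) (C := 2 * ‖x - x'‖) (by
        filter_upwards [ae_restrict_mem (isOpen_domain 1 b).measurableSet] with y hy
        exact abs_green_one_sub_le hb x x' hy)
    refine h.trans ?_
    rw [← hV, ← ENNReal.ofReal_toReal hVt, ← ENNReal.ofReal_mul ENNReal.toReal_nonneg]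
    refine ENNReal.ofReal_le_ofReal ?_
    have hxi : xi 1 γ = 1 := by simp [xi]
    rw [hxi, Real.rpow_one]
    rw [ENNReal.toReal_ofReal ENNReal.toReal_nonneg]
    linarith [norm_nonneg (x - x')]
  · rcases K.eq_empty_or_nonempty with rfl | hne
    · exact ⟨1, one_pos, by simp⟩
    rw [domain_eq_ball hk] at hKD ⊢
    obtain ⟨x₀, hx₀, hmax⟩ := hK.exists_isMaxOn hne continuous_norm.continuousOn
    have hx₀1 : ‖x₀‖ < 1 := by simpa using hKD hx₀
    set c := 1 - ‖x₀‖ with hc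
    have hc0 : 0 < c := by linarith
    have hcle : ∀ x ∈ K, c ≤ 1 - ‖x‖ := fun x hx => by
      have : ‖x‖ ≤ ‖x₀‖ := hmax hx
      linarith
    obtain ⟨C, hC0, hC⟩ := exists_eLpNorm_fundSol_sub_le hk hγ0 hγ1
    set V := (((volume : Measure (Euc k)).restrict (Metric.ball 0 1)) univ ^ (2 : ℝ≥0∞).toReal⁻¹)
      with hV
    have hVt : V ≠ ∞ := ENNReal.rpow_ne_top_of_nonneg (by positivity) (measure_ne_top _ _)
    refine ⟨C + V.toReal * (c⁻¹ ^ 2 * 2) + 1, by positivity, fun x hx x' hx' => ?_⟩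
    have e : green k b x - green k b x' = (fun y => fundSol k ‖x - y‖ - fundSol k ‖x' - y‖) -
        fun y => fundSol k (reflDist x y) - fundSol k (reflDist x' y) := by
      ext y
      simp only [Pi.sub_apply, green_eq hk]
      ring
    have hxx : ‖x - x'‖ ≤ 2 * ‖x - x'‖ ^ xi k γ := by
      rcases eq_or_ne x x' with rfl | hne
      · simp [Real.zero_rpow (xi_pos (Or.inr hk) hγ1).ne']
      have hp : 0 < ‖x - x'‖ := norm_pos_iff.2 (sub_ne_zero.2 hne)
      have h2 : ‖x - x'‖ ≤ 2 := by
        have h1 : ‖x‖ < 1 := by simpa using hKD hx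
        have h1' : ‖x'‖ < 1 := by simpa using hKD hx'
        linarith [norm_sub_le x x']
      have hξ := xi_le_one (Or.inr hk) hγ0
      have hξ0 := xi_pos (Or.inr hk) hγ1
      calc ‖x - x'‖ = ‖x - x'‖ ^ (1 - xi k γ) * ‖x - x'‖ ^ xi k γ := by
            rw [← Real.rpow_add hp, sub_add_cancel, Real.rpow_one]
        _ ≤ 2 ^ (1 - xi k γ) * ‖x - x'‖ ^ xi k γ := by
            gcongr
        _ ≤ 2 ^ (1 : ℝ) * ‖x - x'‖ ^ xi k γ := by
            gcongr
            · exact one_le_two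
            · linarith
        _ = _ := by rw [Real.rpow_one]
    have hreg := eLpNorm_le_of_ae_bound (p := 2)
      (f := fun y => fundSol k (reflDist x y) - fundSol k (reflDist x' y))
      (μ := (volume : Measure (Euc k)).restrict (Metric.ball 0 1))
      (C := c⁻¹ ^ 2 * (2 * ‖x - x'‖ ^ xi k γ)) (by
        filter_upwards [ae_restrict_mem measurableSet_ball] with y hy
        refine (abs_fundSol_sub_le hc0 (by linarith [norm_nonneg x₀])
          ((hcle x hx).trans (one_sub_norm_le_reflDist (hKD hx) hy))
          ((hcle x' hx').trans (one_sub_norm_le_reflDist (hKD hx') hy))).trans ?_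
        gcongr
        exact (abs_reflDist_sub_le x x' hy).trans hxx)
    have hm1 : ∀ z : Euc k, Measurable fun y => fundSol k ‖z - y‖ := fun z =>
      (measurable_fundSol k).comp (by fun_prop)
    have hm2 : ∀ z : Euc k, Measurable fun y => fundSol k (reflDist z y) := fun z =>
      (measurable_fundSol k).comp (measurable_reflDist z)
    rw [e]
    refine (eLpNorm_sub_le ((hm1 x).sub (hm1 x')).aestronglyMeasurable
      ((hm2 x).sub (hm2 x')).aestronglyMeasurable (by norm_num)).trans ?_
    refine (add_le_add (hC x (hKD hx) x' (hKD hx')) hreg).trans ?_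
    rw [← hV, ← ENNReal.ofReal_toReal hVt, ← ENNReal.ofReal_mul ENNReal.toReal_nonneg,
      ← ENNReal.ofReal_add (by positivity) (by positivity)]
    refine ENNReal.ofReal_le_ofReal ?_
    rw [ENNReal.toReal_ofReal ENNReal.toReal_nonneg]
    have : 0 ≤ ‖x - x'‖ ^ xi k γ := by positivity
    linarith

open Classical in
/-- The class of `y ↦ green k b x y` in `L²(D)`. -/
noncomputable def greenLp (k : ℕ) (b : ℝ) (x : Euc k) :
    Lp ℝ 2 ((volume : Measure (Euc k)).restrict (domain k b)) :=
  if h : MemLp (green k b x) 2 ((volume : Measure (Euc k)).restrict (domain k b))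
    then h.toLp (green k b x) else 0

theorem wienerIntegral_green (hk : k = 1 ∨ k = 2 ∨ k = 3) (hb : 0 < b) {x : Euc k}
    (hx : x ∈ domain k b) {Ω : Type*}
    (W : Lp ℝ 2 ((volume : Measure (Euc k)).restrict (domain k b)) → Ω → ℝ) :
    wienerIntegral W (green k b x) = W (greenLp k b x) := by
  have h := memLp_green hk hb hx
  rw [wienerIntegral, greenLp, dif_pos h, dif_pos h]

theorem exists_norm_greenLp_sub_le (hk : k = 1 ∨ k = 2 ∨ k = 3) (hb : 0 < b) {γ : ℝ}
    (hγ0 : 0 < γ) (hγ1 : γ < 1) {K : Set (Euc k)} (hK : IsCompact K) (hKD : K ⊆ domain k b) :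
    ∃ L : ℝ, 0 < L ∧ ∀ x ∈ K, ∀ x' ∈ K,
      ‖greenLp k b x - greenLp k b x'‖ ≤ L * ‖x - x'‖ ^ xi k γ := by
  obtain ⟨L, hL, h⟩ := exists_eLpNorm_green_sub_le hk hb hγ0 hγ1 hK hKD
  refine ⟨L, hL, fun x hx x' hx' => ?_⟩
  have h1 := memLp_green hk hb (hKD hx)
  have h2 := memLp_green hk hb (hKD hx')
  rw [greenLp, greenLp, dif_pos h1, dif_pos h2, ← MemLp.toLp_sub, Lp.norm_toLp]
  exact ENNReal.toReal_le_of_le_ofReal (by positivity) (h x hx x' hx')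

theorem greenLp_ne_zero (hk : k = 1 ∨ k = 2 ∨ k = 3) (hb : 0 < b) {x : Euc k}
    (hx : x ∈ domain k b) : greenLp k b x ≠ 0 := by
  have h := memLp_green hk hb hx
  have hD := (isOpen_domain k b).measurableSet
  have : Nontrivial (Euc k) := by
    rcases hk with rfl | rfl | rfl <;> infer_instance
  rw [greenLp, dif_pos h]
  intro h0
  rw [← MemLp.toLp_zero (MemLp.zero (ε := ℝ)), MemLp.toLp_eq_toLp_iff] at h0
  have hne : ∀ᵐ y ∂(volume : Measure (Euc k)).restrict (domain k b), False := by
    filter_upwards [h0, ae_restrict_mem hD,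
      ae_restrict_of_ae (compl_mem_ae_iff.2 (measure_singleton x))] with y hy hyD hyx
    exact green_ne_zero hk hx hyD (norm_pos_iff.2 (sub_ne_zero.2 fun h => hyx h.symm)) hy
  rw [Filter.eventually_false_iff_eq_bot, ae_eq_bot, Measure.restrict_eq_zero] at hne
  exact ((isOpen_domain k b).measure_pos volume ⟨x, hx⟩).ne' hne

/-- Nondegeneracy of the variance: a continuous, nowhere zero norm attains a positive minimum on a
compact set. -/
theorem exists_norm_greenLp_bounds (hk : k = 1 ∨ k = 2 ∨ k = 3) (hb : 0 < b)
    {K : Set (Euc k)} (hK : IsCompact K) (hKD : K ⊆ domain k b) :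
    ∃ σ₁ σ₂ : ℝ, 0 < σ₁ ∧ ∀ x ∈ K, σ₁ ≤ ‖greenLp k b x‖ ∧ ‖greenLp k b x‖ ≤ σ₂ := by
  rcases K.eq_empty_or_nonempty with rfl | hne
  · exact ⟨1, 1, one_pos, by simp⟩
  -- Only continuity is needed here, so any admissible `γ` would do.
  obtain ⟨L, hL, hLK⟩ := exists_norm_greenLp_sub_le (γ := 1 / 2) hk hb (by norm_num) (by norm_num)
    hK hKD
  have hξ := xi_pos (γ := 1 / 2) hk (by norm_num)
  have hcont : ContinuousOn (fun x => ‖greenLp k b x‖) K := by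
    refine ContinuousOn.norm fun x hx => ?_
    rw [ContinuousWithinAt, tendsto_iff_norm_sub_tendsto_zero]
    have ht : Filter.Tendsto (fun y => L * ‖y - x‖ ^ xi k (1 / 2)) (nhdsWithin x K) (nhds 0) := by
      have : Continuous fun y : Euc k => L * ‖y - x‖ ^ xi k (1 / 2) :=
        continuous_const.mul ((by fun_prop : Continuous fun y : Euc k => ‖y - x‖).rpow_const
          fun _ => Or.inr hξ.le)
      have h := this.continuousWithinAt (s := K) (x := x)
      rwa [ContinuousWithinAt, sub_self, norm_zero, Real.zero_rpow hξ.ne', mul_zero] at h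
    refine squeeze_zero' (Filter.Eventually.of_forall fun _ => norm_nonneg _) ?_ ht
    filter_upwards [self_mem_nhdsWithin] with y hy using hLK y hy x hx
  obtain ⟨x₁, hx₁, h₁⟩ := hK.exists_isMinOn hne hcont
  obtain ⟨x₂, hx₂, h₂⟩ := hK.exists_isMaxOn hne hcont
  exact ⟨_, _, norm_pos_iff.2 (greenLp_ne_zero hk hb (hKD hx₁)), fun x hx => ⟨h₁ hx, h₂ hx⟩⟩

end Green

/-! ### Dyadic points of a cube. -/

section Dyadic

variable {k : ℕ}

theorem norm_le_mul_of_forall_abs_le {x : Euc k} {c : ℝ} (hc : 0 ≤ c) (h : ∀ j, |x j| ≤ c) :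
    ‖x‖ ≤ k * c := by
  rw [EuclideanSpace.norm_eq, Real.sqrt_le_iff]
  refine ⟨by positivity, ?_⟩
  calc ∑ j, ‖x j‖ ^ 2 ≤ ∑ _j : Fin k, c ^ 2 := by
        gcongr with j
        exact h j
    _ = k * c ^ 2 := by simp
    _ ≤ (k : ℝ) ^ 2 * c ^ 2 := by
        gcongr
        rcases Nat.eq_zero_or_pos k with rfl | hk
        · simp
        · exact le_self_pow₀ (by exact_mod_cast hk) two_ne_zero
    _ = (k * c) ^ 2 := by ring

/-- The half-open cube with lower corner `a` and side `δ`. -/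
def cube (a : Euc k) (δ : ℝ) : Set (Euc k) := {x | ∀ j, x j ∈ Ico (a j) (a j + δ)}

/-- The points of the `n`-th dyadic subdivision of `cube a δ`. -/
noncomputable def dyadicPoint (a : Euc k) (δ : ℝ) (n : ℕ) (i : Fin k → Fin (2 ^ n)) : Euc k :=
  WithLp.toLp 2 fun j => a j + δ * ((i j : ℕ) / 2 ^ n)

/-- The dyadic cube of the preceding level that contains a given one. -/
def dyadicParent (k n : ℕ) (i : Fin k → Fin (2 ^ (n + 1))) : Fin k → Fin (2 ^ n) := fun j =>
  ⟨(i j : ℕ) / 2, Nat.div_lt_of_lt_mul ((i j).2.trans_eq (pow_succ' 2 n))⟩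

theorem self_mem_cube (a : Euc k) {δ : ℝ} (hδ : 0 < δ) : a ∈ cube a δ :=
  fun j => ⟨le_rfl, by linarith⟩

theorem norm_sub_le_of_mem_cube {a x y : Euc k} {δ : ℝ} (hδ : 0 ≤ δ) (hx : x ∈ cube a δ)
    (hy : y ∈ cube a δ) : ‖x - y‖ ≤ k * δ := by
  refine norm_le_mul_of_forall_abs_le hδ fun j => ?_
  obtain ⟨h1, h2⟩ := hx j
  obtain ⟨h3, h4⟩ := hy j
  rw [PiLp.sub_apply, abs_le]
  constructor <;> linarith

theorem dyadicPoint_mem_cube (a : Euc k) {δ : ℝ} (hδ : 0 < δ) (n : ℕ) (i : Fin k → Fin (2 ^ n)) :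
    dyadicPoint a δ n i ∈ cube a δ := by
  intro j
  have h : ((i j : ℕ) : ℝ) / 2 ^ n < 1 := by
    rw [div_lt_one (by positivity)]
    exact_mod_cast (i j).2
  have h0 : 0 ≤ ((i j : ℕ) : ℝ) / 2 ^ n := by positivity
  simp only [dyadicPoint]
  constructor <;> nlinarith

theorem dyadicPoint_zero (a : Euc k) (δ : ℝ) (i : Fin k → Fin (2 ^ 0)) :
    dyadicPoint a δ 0 i = a := by
  ext j
  simp [dyadicPoint]

theorem norm_dyadicPoint_sub_parent_le (a : Euc k) {δ : ℝ} (hδ : 0 < δ) (n : ℕ)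
    (i : Fin k → Fin (2 ^ (n + 1))) :
    ‖dyadicPoint a δ (n + 1) i - dyadicPoint a δ n (dyadicParent k n i)‖ ≤ k * (δ / 2 ^ n) := by
  refine norm_le_mul_of_forall_abs_le (by positivity) fun j => ?_
  obtain ⟨m, r, hr, hm⟩ : ∃ m r : ℕ, r ≤ 1 ∧ (i j : ℕ) = 2 * m + r :=
    ⟨(i j : ℕ) / 2, (i j : ℕ) % 2, by omega, by omega⟩
  have hm2 : (2 * m + r) / 2 = m := by omega
  have e : (dyadicPoint a δ (n + 1) i - dyadicPoint a δ n (dyadicParent k n i)) j =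
      δ / 2 ^ n * (r / 2) := by
    simp only [PiLp.sub_apply, dyadicPoint, dyadicParent, hm, hm2]
    push_cast
    field_simp
    ring
  have hr' : (r : ℝ) ≤ 1 := by exact_mod_cast hr
  rw [e, abs_of_nonneg (by positivity)]
  exact mul_le_of_le_one_right (by positivity) (by linarith)

theorem exists_norm_dyadicPoint_sub_le {a x : Euc k} {δ : ℝ} (hδ : 0 < δ) (hx : x ∈ cube a δ)
    (n : ℕ) : ∃ i, ‖dyadicPoint a δ n i - x‖ ≤ k * (δ / 2 ^ n) := by
  have h0 : ∀ j, 0 ≤ (x j - a j) / δ * 2 ^ n := fun j => by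
    have := (hx j).1
    have : 0 ≤ x j - a j := by linarith
    positivity
  have hlt : ∀ j, ⌊(x j - a j) / δ * 2 ^ n⌋₊ < 2 ^ n := fun j => by
    rw [Nat.floor_lt (h0 j)]
    push_cast
    have : (x j - a j) / δ < 1 := by
      rw [div_lt_one hδ]
      linarith [(hx j).2]
    exact mul_lt_of_lt_one_left (by positivity) this
  refine ⟨fun j => ⟨_, hlt j⟩, norm_le_mul_of_forall_abs_le (by positivity) fun j => ?_⟩
  have h1 := Nat.floor_le (h0 j)
  have h2 := Nat.lt_floor_add_one ((x j - a j) / δ * 2 ^ n)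
  set m : ℝ := (⌊(x j - a j) / δ * 2 ^ n⌋₊ : ℝ) with hm
  have e : (dyadicPoint a δ n (fun j => ⟨_, hlt j⟩) - x) j =
      δ / 2 ^ n * (m - (x j - a j) / δ * 2 ^ n) := by
    simp only [PiLp.sub_apply, dyadicPoint, ← hm]
    field_simp
    ring
  rw [e, abs_mul, abs_of_pos (show 0 < δ / 2 ^ n by positivity)]
  refine mul_le_of_le_one_right (by positivity) ?_
  rw [abs_le]
  constructor <;> linarith

end Dyadic

/-! ### Independence of the components. -/

section WhiteNoise

variable {S Ω : Type*} [MeasurableSpace S] [MeasurableSpace Ω] {d : ℕ} {μ : Measure S}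
  {W : Fin d → Lp ℝ 2 μ → Ω → ℝ} {P : Measure Ω}

theorem IsWhiteNoise.isIsonormal (hW : IsWhiteNoise μ W P) (i : Fin d) : IsIsonormal (W i) P where
  isGaussianProcess := hW.isGaussianProcess.comp_right fun h => (i, h)
  mean_zero := hW.mean_zero i
  covariance g h := by simpa using hW.covariance i i g h

theorem IsWhiteNoise.iIndepFun (hW : IsWhiteNoise μ W P) [IsProbabilityMeasure P] {ι : Type*}
    (g : ι → Lp ℝ 2 μ) : iIndepFun (fun i ω t => W i (g t) ω) P := by
  refine IsGaussianProcess.iIndepFun_of_covariance_eq_zero (S := fun _ => ι)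
    (X := fun i t => W i (g t))
    (hW.isGaussianProcess.comp_right fun p : (_ : Fin d) × ι => (p.1, g p.2))
    (fun i t => (hW.isIsonormal i).aemeasurable _) fun i j hij t u => ?_
  rw [covariance_eq_sub ((hW.isIsonormal i).memLp_two _) ((hW.isIsonormal j).memLp_two _),
    hW.mean_zero, hW.mean_zero]
  simpa [hij] using hW.covariance i j (g t) (g u)

/-- Allowing each coordinate its own index `t` only enlarges the event, which then factors by
independence. -/
theorem IsWhiteNoise.measure_exists_forall_lt_le (hW : IsWhiteNoise μ W P)
    [IsProbabilityMeasure P] {ι : Type*} [Countable ι] (g : ι → Lp ℝ 2 μ) (z : Fin d → ℝ) (s : ℝ) :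
    P {ω | ∃ t, ∀ i, |W i (g t) ω - z i| < s} ≤
      ∏ i, P {ω | ∃ t, |W i (g t) ω - z i| < s} := by
  have hind := hW.iIndepFun g
  have hB : ∀ i, MeasurableSet {y : ι → ℝ | ∃ t, |y t - z i| < s} := fun i => by
    simp only [ofPred_exists]
    exact MeasurableSet.iUnion fun t => measurableSet_lt (by fun_prop) measurable_const
  have h := hind.measure_inter_preimage_eq_mul Finset.univ
    (sets := fun i => {y : ι → ℝ | ∃ t, |y t - z i| < s}) fun i _ => hB i
  calc P {ω | ∃ t, ∀ i, |W i (g t) ω - z i| < s}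
      ≤ P (⋂ i ∈ Finset.univ, (fun ω t => W i (g t) ω) ⁻¹' {y : ι → ℝ | ∃ t, |y t - z i| < s}) := by
        refine measure_mono ?_
        rintro ω ⟨t, ht⟩
        simp only [Finset.mem_univ, iInter_true, mem_iInter]
        exact fun i => ⟨t, ht i⟩
    _ = _ := h

end WhiteNoise

/-! ### Hitting probability on one small cube. -/

section Cube

variable {k : ℕ} {b : ℝ}

/-- The chaining bound for the residuals of the Green kernels along the dyadic points of a cube
of side `ε ^ (1 / ξ)`, and the resulting bound for one component to come close to a given value. -/
theorem exists_component_hitting_const (hk : k = 1 ∨ k = 2 ∨ k = 3) (hb : 0 < b) {γ : ℝ}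
    (hγ0 : 0 < γ) (hγ1 : γ < 1) {K : Set (Euc k)} (hK : IsCompact K) (hKD : K ⊆ domain k b) :
    ∃ C : ℝ, 0 < C ∧ ∀ (Ω : Type u) [MeasurableSpace Ω] (P : Measure Ω)
      (X : Lp ℝ 2 ((volume : Measure (Euc k)).restrict (domain k b)) → Ω → ℝ), IsIsonormal X P →
      ∀ (a : Euc k) (ε : ℝ), 0 < ε → cube a (ε ^ (1 / xi k γ)) ⊆ K → ∀ z : ℝ,
        P {ω | ∃ p : (n : ℕ) × (Fin k → Fin (2 ^ n)),
          |X (greenLp k b (dyadicPoint a (ε ^ (1 / xi k γ)) p.1 p.2)) ω - z| < 2 * ε} ≤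
        ENNReal.ofReal (C * ε) := by
  set ξ := xi k γ with hξdef
  have hξ : 0 < ξ := xi_pos hk hγ1
  -- Chosen so that `θ ^ (2 * n) = 2 ^ (-n * ξ)`, the Hölder gain at the `n`-th dyadic scale.
  set θ : ℝ := 2 ^ (-(ξ / 2)) with hθ
  have hθ0 : 0 < θ := by positivity
  have hθ1 : θ < 1 := Real.rpow_lt_one_of_one_lt_of_neg one_lt_two (by linarith)
  obtain ⟨C₀, hC₀, hchain⟩ := exists_chaining_const.{u} hθ0 hθ1 (2 ^ k)
  obtain ⟨L, hL, hLK⟩ := exists_norm_greenLp_sub_le hk hb hγ0 hγ1 hK hKD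
  obtain ⟨σ₁, σ₂, hσ₁, hσ⟩ := exists_norm_greenLp_bounds hk hb hK hKD
  obtain ⟨C₁, hC₁, hhit⟩ := exists_hitting_const.{u}
    (H := Lp ℝ 2 ((volume : Measure (Euc k)).restrict (domain k b))) hσ₁ σ₂ C₀
  -- `s = A * ε` dominates both the near-hit radius `2 * ε` and the variation `L * (k * δ) ^ ξ` of
  -- the kernels over the cube.
  set A : ℝ := 2 + L * (k : ℝ) ^ ξ with hA
  have hk0 : (0 : ℝ) ≤ L * (k : ℝ) ^ ξ := by positivity
  have hA0 : 0 < A := by positivity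
  refine ⟨C₁ * A, by positivity, fun Ω _ P X hX a ε hε haK z => ?_⟩
  set δ := ε ^ (1 / ξ) with hδdef
  have hδ : 0 < δ := by positivity
  have hδξ : δ ^ ξ = ε := by
    rw [hδdef, ← Real.rpow_mul hε.le, one_div_mul_cancel hξ.ne', Real.rpow_one]
  set s := A * ε with hs
  have hs0 : 0 < s := by positivity
  have haK' : a ∈ K := haK (self_mem_cube a hδ)
  have hdK : ∀ n i, dyadicPoint a δ n i ∈ K := fun n i => haK (dyadicPoint_mem_cube a hδ n i)
  have hg0 : greenLp k b a ≠ 0 := norm_pos_iff.1 (hσ₁.trans_le (hσ a haK').1)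
  have hθn : ∀ n : ℕ, ((2 : ℝ) ^ n) ^ ξ = (θ ^ (2 * n))⁻¹ := fun n => by
    rw [hθ, ← Real.rpow_natCast, ← Real.rpow_natCast, ← Real.rpow_mul (by norm_num),
      ← Real.rpow_mul (by norm_num), ← Real.rpow_neg (by norm_num)]
    congr 1
    push_cast
    ring
  have hLs : L * (k : ℝ) ^ ξ * ε ≤ s := by
    rw [hs, hA]
    nlinarith
  have hsup := hchain Ω P X hX (fun n => Fin k → Fin (2 ^ n)) (dyadicParent k)
    (fun n i => residual (greenLp k b a) (greenLp k b (dyadicPoint a δ n i))) s hs0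
    (fun n => by simp [← pow_mul, mul_comm])
    (fun i => by rw [dyadicPoint_zero, residual_self hg0])
    (fun n i => by
      rw [residual_sub]
      refine (norm_residual_le hg0 _).trans ((hLK _ (hdK _ _) _ (hdK _ _)).trans ?_)
      calc L * ‖dyadicPoint a δ (n + 1) i - dyadicPoint a δ n (dyadicParent k n i)‖ ^ ξ
          ≤ L * (k * (δ / 2 ^ n)) ^ ξ := by
            gcongr
            exact norm_dyadicPoint_sub_parent_le a hδ n i
        _ = L * (k : ℝ) ^ ξ * ε * θ ^ (2 * n) := by
            rw [Real.mul_rpow (by positivity) (by positivity),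
              Real.div_rpow hδ.le (by positivity), hδξ, hθn, div_inv_eq_mul]
            ring
        _ ≤ s * θ ^ (2 * n) := by gcongr)
  have hfin := hhit Ω P X hX ((n : ℕ) × (Fin k → Fin (2 ^ n)))
    (fun p => greenLp k b (dyadicPoint a δ p.1 p.2)) (greenLp k b a) s hs0 (hσ a haK').1
    (hσ a haK').2
    (fun p => by
      refine (hLK _ (hdK _ _) _ haK').trans (le_trans ?_ hLs)
      rw [mul_assoc, ← hδξ, ← Real.mul_rpow (by positivity) hδ.le]
      gcongr
      exact norm_sub_le_of_mem_cube hδ.le (dyadicPoint_mem_cube a hδ _ _) (self_mem_cube a hδ))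
    hsup z
  calc _ ≤ P {ω | ∃ p : (n : ℕ) × (Fin k → Fin (2 ^ n)),
          |X (greenLp k b (dyadicPoint a δ p.1 p.2)) ω - z| < s} := by
        refine measure_mono ?_
        rintro ω ⟨p, hp⟩
        refine ⟨p, hp.trans_le ?_⟩
        rw [hs, hA]
        nlinarith
    _ ≤ ENNReal.ofReal (C₁ * A * ε) := by
        rw [mul_assoc]
        exact hfin

/-- The probability that `v` maps some point of a cube of side `ε ^ (1 / ξ)` into a given ball of
radius `ε` is `O(ε ^ d)`. -/
theorem exists_cube_hitting_const (d : ℕ) (hk : k = 1 ∨ k = 2 ∨ k = 3) (hb : 0 < b) {γ : ℝ}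
    (hγ0 : 0 < γ) (hγ1 : γ < 1) {K : Set (Euc k)} (hK : IsCompact K) (hKD : K ⊆ domain k b) :
    ∃ C : ℝ, 0 < C ∧ ∀ (Ω : Type u) [MeasurableSpace Ω] (P : Measure Ω) [IsProbabilityMeasure P]
      (W : Fin d → Lp ℝ 2 ((volume : Measure (Euc k)).restrict (domain k b)) → Ω → ℝ)
      (v : Euc k → Ω → Euc d),
      IsWhiteNoise ((volume : Measure (Euc k)).restrict (domain k b)) W P →
      IsGaussianSolution b W v P →
      ∀ (a : Euc k) (ε : ℝ), 0 < ε → cube a (ε ^ (1 / xi k γ)) ⊆ K → ∀ z : Euc d,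
        P {ω | ∃ x ∈ cube a (ε ^ (1 / xi k γ)), v x ω ∈ Metric.closedBall z ε} ≤
          ENNReal.ofReal ((C * ε) ^ d) := by
  obtain ⟨C, hC, hcomp⟩ := exists_component_hitting_const.{u} hk hb hγ0 hγ1 hK hKD
  refine ⟨C, hC, fun Ω _ P _ W v hW hv a ε hε haK z => ?_⟩
  set δ := ε ^ (1 / xi k γ) with hδdef
  have hδ : 0 < δ := by positivity
  have hdK : ∀ n i, dyadicPoint a δ n i ∈ K := fun n i => haK (dyadicPoint_mem_cube a hδ n i)
  have hae : ∀ᵐ ω ∂P, ∀ (p : (n : ℕ) × (Fin k → Fin (2 ^ n))) (i : Fin d),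
      v (dyadicPoint a δ p.1 p.2) ω i = W i (greenLp k b (dyadicPoint a δ p.1 p.2)) ω := by
    simp_rw [ae_all_iff]
    intro p i
    have hD := hKD (hdK p.1 p.2)
    filter_upwards [hv.ae_eq _ hD i] with ω hω
    rw [hω, wienerIntegral_green hk hb hD]
  -- Path continuity reduces the cube to its countably many dyadic points; doubling the radius makes
  -- the target open, so nearby dyadic points also hit it.
  have hsub : P {ω | ∃ x ∈ cube a δ, v x ω ∈ Metric.closedBall z ε} ≤
      P {ω | ∃ p : (n : ℕ) × (Fin k → Fin (2 ^ n)), ∀ i,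
        |W i (greenLp k b (dyadicPoint a δ p.1 p.2)) ω - z i| < 2 * ε} := by
    refine measure_mono_ae ?_
    filter_upwards [hae, hv.ae_continuousOn] with ω hω hcont
    rintro ⟨x, hx, hxz⟩
    choose i hi using exists_norm_dyadicPoint_sub_le hδ hx
    have ht : Filter.Tendsto (fun n => dyadicPoint a δ n (i n)) Filter.atTop
        (nhdsWithin x (domain k b)) := by
      refine tendsto_nhdsWithin_iff.2 ⟨?_, Filter.Eventually.of_forall fun n => hKD (hdK _ _)⟩
      rw [tendsto_iff_norm_sub_tendsto_zero]
      refine squeeze_zero (fun _ => norm_nonneg _) hi ?_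
      have := (tendsto_pow_atTop_nhds_zero_of_lt_one (r := (1 / 2 : ℝ)) (by norm_num)
        (by norm_num)).const_mul (k * δ)
      rw [mul_zero] at this
      refine this.congr fun n => ?_
      rw [one_div, inv_pow]
      ring
    have htv := (hcont x (hKD (haK hx))).tendsto.comp ht
    have hball : ∀ᶠ n in Filter.atTop, v (dyadicPoint a δ n (i n)) ω ∈ Metric.ball z (2 * ε) := by
      refine htv.eventually (Metric.isOpen_ball.mem_nhds ?_)
      rw [Metric.mem_closedBall] at hxz
      rw [Metric.mem_ball]
      linarith
    obtain ⟨n, hn⟩ := hball.exists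
    refine ⟨⟨n, i n⟩, fun j => ?_⟩
    rw [← hω ⟨n, i n⟩ j]
    rw [mem_ball_iff_norm] at hn
    exact (PiLp.norm_apply_le (v (dyadicPoint a δ n (i n)) ω - z) j).trans_lt hn
  refine hsub.trans ((hW.measure_exists_forall_lt_le _ _ _).trans ?_)
  calc ∏ i, P {ω | ∃ p : (n : ℕ) × (Fin k → Fin (2 ^ n)),
          |W i (greenLp k b (dyadicPoint a δ p.1 p.2)) ω - z i| < 2 * ε}
      ≤ ∏ _i : Fin d, ENNReal.ofReal (C * ε) :=
        Finset.prod_le_prod' fun i _ => hcomp Ω P (W i) (hW.isIsonormal i) a ε hε haK (z i)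
    _ = ENNReal.ofReal ((C * ε) ^ d) := by
        rw [Finset.prod_const, Finset.card_univ, Fintype.card_fin, ENNReal.ofReal_pow (by positivity)]

end Cube

/-! ### Compact inner domains and covering by cubes. -/

section Inner

variable {k : ℕ}

/-- The points at distance at least `r` from the complement of `D`. -/
def innerSet (D : Set (Euc k)) (r : ℝ) : Set (Euc k) := {x | ∀ y ∉ D, r ≤ dist x y}

theorem innerSet_subset (D : Set (Euc k)) {r : ℝ} (hr : 0 < r) : innerSet D r ⊆ D := by
  intro x hx
  by_contra h
  have := hx x h
  rw [dist_self] at this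
  linarith

theorem isCompact_innerSet {D : Set (Euc k)} (hD : Bornology.IsBounded D) {r : ℝ} (hr : 0 < r) :
    IsCompact (innerSet D r) := by
  refine Metric.isCompact_of_isClosed_isBounded ?_ (hD.subset (innerSet_subset D hr))
  simp only [innerSet, ofPred_forall]
  exact isClosed_iInter fun y => isClosed_iInter fun _ =>
    isClosed_le continuous_const (continuous_id.dist continuous_const)

/-- The distance from a point of `D` to the complement is attained on the frontier. -/
theorem mem_innerSet_of_le_infDist_frontier {D : Set (Euc k)} {r : ℝ} {x : Euc k} (hx : x ∈ D)
    (h : r ≤ Metric.infDist x (frontier D)) : x ∈ innerSet D r := by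
  intro y hy
  obtain ⟨w, hw, hwd⟩ := exists_mem_frontier_infDist_compl_eq_dist hx
    (fun hu => hy (hu ▸ mem_univ y))
  calc r ≤ dist x w := h.trans (Metric.infDist_le_dist_of_mem hw)
    _ ≤ dist x y := hwd ▸ Metric.infDist_le_dist_of_mem hy

theorem mem_innerSet_of_dist_le {D : Set (Euc k)} {r : ℝ} {x y : Euc k} (hx : x ∈ innerSet D r)
    (h : dist x y ≤ r / 2) : y ∈ innerSet D (r / 2) := by
  intro w hw
  linarith [hx w hw, dist_triangle x y w]

/-- The grid cubes of side `δ ≤ 1` meeting a bounded set are contained in a finite family of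
cardinality `O(δ ^ (-k))`. -/
theorem exists_finset_grid {R δ : ℝ} (hR : 0 ≤ R) (hδ : 0 < δ) (hδ1 : δ ≤ 1) :
    ∃ J : Finset (Euc k), (J.card : ℝ) ≤ ((2 * R + 3) / δ) ^ k ∧
      ∀ x : Euc k, ‖x‖ ≤ R → ∃ a ∈ J, x ∈ cube a δ := by
  classical
  set M : ℤ := ⌈R / δ⌉ with hM
  have hM0 : 0 ≤ M := Int.ceil_nonneg (by positivity)
  refine ⟨(Fintype.piFinset fun _ : Fin k => Finset.Icc (-M) M).image
    fun m => WithLp.toLp 2 fun j => δ * (m j : ℝ), ?_, fun x hx => ?_⟩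
  · have h1 : ((2 * M + 1 : ℤ) : ℝ) ≤ (2 * R + 3) / δ := by
      have h2 : (M : ℝ) < R / δ + 1 := Int.ceil_lt_add_one _
      have h3 : 3 ≤ 3 / δ := by
        rw [le_div_iff₀ hδ]
        linarith
      push_cast
      rw [add_div, mul_div_assoc]
      linarith
    calc (Finset.card _ : ℝ) ≤ ((Fintype.piFinset fun _ : Fin k => Finset.Icc (-M) M).card : ℝ) := by
          exact_mod_cast Finset.card_image_le
      _ = ((2 * M + 1 : ℤ) : ℝ) ^ k := by
          have : ((M + 1 - -M).toNat : ℤ) = 2 * M + 1 := by omega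
          rw [Fintype.card_piFinset_const, Int.card_Icc, Nat.cast_pow, ← Int.cast_natCast, this]
      _ ≤ _ := by
          gcongr
  · refine ⟨_, Finset.mem_image_of_mem _ (a := fun j => ⌊x j / δ⌋) ?_, fun j => ?_⟩
    · rw [Fintype.mem_piFinset]
      intro j
      have hj : |x j| ≤ R := (PiLp.norm_apply_le x j).trans hx
      rw [Finset.mem_Icc]
      constructor
      · rw [Int.le_floor, hM]
        have h2 := Int.le_ceil (R / δ)
        have h3 : -(R / δ) ≤ x j / δ := by
          rw [← neg_div]
          gcongr
          exact (abs_le.1 hj).1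
        push_cast
        linarith
      · refine (Int.floor_le_ceil _).trans (Int.ceil_le_ceil ?_)
        gcongr
        exact (abs_le.1 hj).2
    · have h1 := Int.floor_le (x j / δ)
      have h2 := Int.lt_floor_add_one (x j / δ)
      rw [le_div_iff₀ hδ] at h1
      rw [div_lt_iff₀ hδ] at h2
      change δ * (⌊x j / δ⌋ : ℝ) ≤ x j ∧ x j < δ * (⌊x j / δ⌋ : ℝ) + δ
      constructor <;> linarith

end Inner

/-- The probability that `v` hits a ball of radius `ε` is `O(ε ^ (d - k / ξ))`. -/
theorem exists_ball_hitting_const {k : ℕ} (d : ℕ) (hk : k = 1 ∨ k = 2 ∨ k = 3) {b : ℝ} (hb : 0 < b)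
    {γ : ℝ} (hγ0 : 0 < γ) (hγ1 : γ < 1) {d₀ : ℝ} (hd₀ : 0 < d₀) :
    ∃ C ε₀ : ℝ, 0 < C ∧ 0 < ε₀ ∧
      ∀ (Ω : Type u) [MeasurableSpace Ω] (P : Measure Ω) [IsProbabilityMeasure P]
        (W : Fin d → Lp ℝ 2 ((volume : Measure (Euc k)).restrict (domain k b)) → Ω → ℝ)
        (v : Euc k → Ω → Euc d),
        IsWhiteNoise ((volume : Measure (Euc k)).restrict (domain k b)) W P →
        IsGaussianSolution b W v P →
        ∀ I : Set (Euc k), I ⊆ innerSet (domain k b) d₀ → ∀ (ε : ℝ), 0 < ε → ε ≤ ε₀ →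
          ∀ z : Euc d, P {ω | ∃ x ∈ I, v x ω ∈ Metric.closedBall z ε} ≤
            ENNReal.ofReal (C * ε ^ ((d : ℝ) - (k : ℝ) / xi k γ)) := by
  have hξ := xi_pos hk hγ1
  have hDb := isBounded_domain k b
  obtain ⟨R, hR0, hR⟩ := hDb.exists_pos_norm_le
  -- The compact set is taken at distance `d₀ / 2`: it does not depend on `I`, and it leaves room
  -- for the small cubes that meet `I`.
  obtain ⟨C, hC, hcube⟩ := exists_cube_hitting_const.{u} d hk hb hγ0 hγ1
    (isCompact_innerSet hDb (half_pos hd₀)) (innerSet_subset (domain k b) (half_pos hd₀))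
  -- The grid bound needs `δ ≤ 1`, and containment of the cubes needs the diameter bound `k * δ ≤ d₀
  -- / 2`.
  set δ₀ : ℝ := min 1 (d₀ / 2 / (k + 1)) with hδ₀
  have hδ₀0 : 0 < δ₀ := by positivity
  refine ⟨(2 * R + 3) ^ k * C ^ d, δ₀ ^ xi k γ, by positivity, by positivity, ?_⟩
  intro Ω _ P _ W v hW hv I hI ε hε hεle z
  set δ := ε ^ (1 / xi k γ) with hδdef
  have hδ : 0 < δ := by positivity
  have hδle : δ ≤ δ₀ := by
    calc δ ≤ (δ₀ ^ xi k γ) ^ (1 / xi k γ) :=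
          Real.rpow_le_rpow hε.le hεle (by positivity)
      _ = δ₀ := by rw [← Real.rpow_mul hδ₀0.le, mul_one_div_cancel hξ.ne', Real.rpow_one]
  have hkδ : k * δ ≤ d₀ / 2 := by
    have h1 : δ ≤ d₀ / 2 / (k + 1) := hδle.trans (min_le_right _ _)
    rw [le_div_iff₀ (by positivity)] at h1
    linarith
  obtain ⟨J, hJcard, hJ⟩ := exists_finset_grid (k := k) hR0.le hδ (hδle.trans (min_le_left _ _))
  have hID : I ⊆ domain k b := hI.trans (innerSet_subset _ hd₀)
  have hsub : {ω | ∃ x ∈ I, v x ω ∈ Metric.closedBall z ε} ⊆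
      ⋃ a ∈ J, {ω | ∃ x ∈ I ∩ cube a δ, v x ω ∈ Metric.closedBall z ε} := by
    rintro ω ⟨x, hx, hxz⟩
    obtain ⟨a, ha, hxa⟩ := hJ x (hR x (hID hx))
    exact mem_biUnion ha ⟨x, ⟨hx, hxa⟩, hxz⟩
  have hone : ∀ a ∈ J, P {ω | ∃ x ∈ I ∩ cube a δ, v x ω ∈ Metric.closedBall z ε} ≤
      ENNReal.ofReal ((C * ε) ^ d) := by
    intro a _
    rcases (I ∩ cube a δ).eq_empty_or_nonempty with he | ⟨x, hxI, hxa⟩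
    · simp [he]
    · refine le_trans (measure_mono ?_) (hcube Ω P W v hW hv a ε hε (fun y hy => ?_) z)
      · rintro ω ⟨y, hy, hyz⟩
        exact ⟨y, hy.2, hyz⟩
      · refine mem_innerSet_of_dist_le (hI hxI) ?_
        rw [dist_eq_norm]
        exact (norm_sub_le_of_mem_cube hδ.le hxa hy).trans hkδ
  calc P {ω | ∃ x ∈ I, v x ω ∈ Metric.closedBall z ε}
      ≤ ∑ a ∈ J, P {ω | ∃ x ∈ I ∩ cube a δ, v x ω ∈ Metric.closedBall z ε} :=
        (measure_mono hsub).trans (measure_biUnion_finset_le _ _)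
    _ ≤ ∑ _a ∈ J, ENNReal.ofReal ((C * ε) ^ d) := Finset.sum_le_sum hone
    _ = ENNReal.ofReal (J.card * (C * ε) ^ d) := by
        rw [Finset.sum_const, nsmul_eq_mul, ENNReal.ofReal_mul (by positivity),
          ENNReal.ofReal_natCast]
    _ ≤ ENNReal.ofReal ((2 * R + 3) ^ k * C ^ d * ε ^ ((d : ℝ) - (k : ℝ) / xi k γ)) := by
        refine ENNReal.ofReal_le_ofReal ?_
        calc (J.card : ℝ) * (C * ε) ^ d ≤ ((2 * R + 3) / δ) ^ k * (C * ε) ^ d := by gcongr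
          _ = _ := by
            have h1 : δ ^ k = ε ^ ((k : ℝ) / xi k γ) := by
              rw [hδdef, ← Real.rpow_mul_natCast hε.le]
              congr 1
              ring
            rw [Real.rpow_sub hε, Real.rpow_natCast, div_pow, h1]
            ring

end PoissonHitting

/-! ### Conclusion. -/

theorem mainTheorem2 (k d : ℕ) (hk : k = 1 ∨ k = 2 ∨ k = 3) (b : ℝ) (hb : 0 < b)
    (γ : ℝ) (hγ0 : 0 < γ) (hγ1 : γ < 1) (d₀ : ℝ) (hd₀ : 0 < d₀) :
    ∃ C : ℝ, 0 < C ∧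
      ∀ (Ω : Type*) [MeasurableSpace Ω] (P : Measure Ω) [IsProbabilityMeasure P]
        (W : Fin d → Lp ℝ 2 ((volume : Measure (Euc k)).restrict (domain k b)) → Ω → ℝ)
        (v : Euc k → Ω → Euc d),
        IsWhiteNoise ((volume : Measure (Euc k)).restrict (domain k b)) W P →
        IsGaussianSolution b W v P →
        ∀ I : Set (Euc k), IsCompact I → I ⊆ domain k b →
          (∀ x ∈ I, d₀ ≤ Metric.infDist x (frontier (domain k b))) →
          ∀ A : Set (Euc d), MeasurableSet A →
            P {ω | (((fun x => v x ω) '' I) ∩ A).Nonempty} ≤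
              ENNReal.ofReal C * μH[(d : ℝ) - (k : ℝ) / xi k γ] A := by
  set s : ℝ := (d : ℝ) - (k : ℝ) / xi k γ with hs
  -- For `s ≤ 0` a nonempty set of diameter at most `1` has `diam ^ s ≥ 1`, so probability at most
  -- `1` suffices.
  rcases le_or_gt s 0 with hs0 | hs0
  · refine ⟨1, one_pos, fun Ω _ P _ W v hW hv I hI hID hId A _ => ?_⟩
    refine measure_hitting_le_hausdorffMeasure _ (r₀ := 1) (by simp) (by simp) one_pos
      (fun E _ hE1 => prob_le_one.trans ?_) A
    rw [ENNReal.ofReal_one, one_mul]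
    rw [← neg_neg s, ENNReal.rpow_neg, ENNReal.one_le_inv]
    exact ENNReal.rpow_le_one hE1 (by linarith)
  · obtain ⟨C, ε₀, hC, hε₀, h⟩ := exists_ball_hitting_const d hk hb hγ0 hγ1 hd₀
    refine ⟨C, hC, fun Ω _ P _ W v hW hv I hI hID hId A _ => ?_⟩
    have hI' : I ⊆ innerSet (domain k b) d₀ := fun x hx =>
      mem_innerSet_of_le_infDist_frontier (hID hx) (hId x hx)
    refine measure_hitting_le_hausdorffMeasure _ (r₀ := ENNReal.ofReal ε₀) (by simpa using hC)
      (by simp) (by simpa using hε₀) (fun E hE hEr => ?_) A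
    obtain ⟨z, hz⟩ := hE
    have hfin : Metric.ediam E ≠ ⊤ := (hEr.trans_lt ENNReal.ofReal_lt_top).ne
    have key : ∀ ε : ℝ, 0 < ε → ε ≤ ε₀ → Metric.ediam E ≤ ENNReal.ofReal ε →
        P {ω | (((fun x => v x ω) '' I) ∩ E).Nonempty} ≤ ENNReal.ofReal C * ENNReal.ofReal ε ^ s := by
      intro ε hε hεle hEε
      have h1 := h Ω P W v hW hv I hI' ε hε hεle z
      rw [ENNReal.ofReal_mul hC.le, ← ENNReal.ofReal_rpow_of_pos hε] at h1
      refine (measure_mono ?_).trans h1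
      rintro ω ⟨y, ⟨x, hx, rfl⟩, hyE⟩
      refine ⟨x, hx, ?_⟩
      rw [Metric.mem_closedBall, dist_edist]
      exact ENNReal.toReal_le_of_le_ofReal hε.le ((Metric.edist_le_ediam_of_mem hyE hz).trans hEε)
    -- Diameter `0` is not an admissible radius in the ball estimate; it is reached by letting `ε →
    -- 0`, using `s > 0`.
    rcases eq_or_ne (Metric.ediam E) 0 with h0 | h0
    · rw [h0, ENNReal.zero_rpow_of_pos hs0, mul_zero]
      have ht : Filter.Tendsto (fun ε : ℝ => ENNReal.ofReal C * ENNReal.ofReal ε ^ s)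
          (nhdsWithin 0 (Set.Ioi 0)) (nhds 0) := by
        have hc : Continuous fun ε : ℝ => ENNReal.ofReal C * ENNReal.ofReal ε ^ s :=
          (ENNReal.continuous_const_mul ENNReal.ofReal_ne_top).comp
            (ENNReal.continuous_rpow_const.comp ENNReal.continuous_ofReal)
        have := hc.continuousWithinAt (s := Set.Ioi 0) (x := 0)
        simpa [ContinuousWithinAt, ENNReal.zero_rpow_of_pos hs0] using this
      refine ge_of_tendsto ht ?_
      filter_upwards [Ioo_mem_nhdsGT hε₀] with ε hε
      exact key ε hε.1 hε.2.le (by simp [h0])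
    · have hp : 0 < (Metric.ediam E).toReal := ENNReal.toReal_pos h0 hfin
      have h1 := key _ hp (ENNReal.toReal_le_of_le_ofReal hε₀.le hEr)
        (ENNReal.ofReal_toReal hfin).ge
      rwa [ENNReal.ofReal_toReal hfin] at h1
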